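/- Consider the complete bipartite graph $K_{n,n}$ with layers $\alpha_1,\dots,\alpha_n$ and $\beta_1,\dots,\beta_n$ and real edge weights $w_e$. Let $w_{\max}=\max_e |w_e|$, let $W(M)=\sum_{e\in M}w_e$ for a perfect matching $M$, let $W_{\mathrm{opt}}$ be the maximum of $W$ over all perfect matchings, and let the uniqueness gap $\varepsilon$ be the difference between the weights of the best and the second best perfect matching. Belief propagation (BP) is the max-sum algorithm: all messages are initially zero, and in iteration $t\ge 1$ each node $u$ sends to each neighbour $v$ the message $$m^{t}_{u\to v}(r)=\max_{s:\ (s=v\,\Leftrightarrow\, r=u)}\Big(w_{uv}\mathbf 1[s=v]+\sum_{l\neq v}m^{t-1}_{l\to u}(s)\Big),$$ where $r$ and $s$ are candidate partners of $v$ and $u$. The belief of $u$ in iteration $t$ is an edge $\{u,s\}$ that maximizes $\sum_l m^t_{l\to u}(s)$ (ties are broken arbitrarily). The partial BP matching of iteration $t$ is the set of edges that are the belief of both of their endpoints; a completion of it is a perfect matching that contains it. Theorem. There are constants $a,b,c_1,c_2>0$ and $N$ such that for all $n\ge N$, all $w_{\max}>0$ and all $0<\varepsilon<\frac{w_{\max}}{4(n-2)}$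 there are edge weights on $K_{n,n}$ with maximum absolute value $w_{\max}$, uniqueness gap $\varepsilon$ and $W_{\mathrm{opt}}>0$ such that for every iteration $$1\le t\le \min\Big\{(n\log n)^{a\sqrt{n/\log n}},\ \ b\cdot\frac{w_{\max}}{\sqrt{n^3/\log n}\cdot\varepsilon}\Big\}$$ every completion $M$ of a partial BP matching of iteration $t$ is only $\big(1-\Theta(1/\sqrt{n\log n})\big)$-approximate, that is, $$\Big(1-\frac{c_2}{\sqrt{n\log n}}\Big)W_{\mathrm{opt}}\le W(M)\le\Big(1-\frac{c_1}{\sqrt{n\log n}}\Big)W_{\mathrm{opt}}.$$ Moreover, the weights can be chosen as follows. Let $c=\lfloor\frac12\sqrt{n/\log n}\rfloor$ and $h=w_{\max}/2$. There are $c$ node-disjoint cycles in $K_{n,n}$ whose half-lengths $n_1<\dots<n_c$ are primes in the open interval $(\frac n{2c},\frac nc)$. The edges $\{\alpha_k,\beta_k\}$ have weight $h/2$ for all $k$; those with both ends on a cycle form one of the two perfect matchings of each cycle. In the other perfect matching of the $i$-th cycle one edge has weight $h$ and the remaining ones have weight $\frac h2-\frac h{2(n_i-1)}-\frac{\varepsilon}{n_i-1}$.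 All other edges of $K_{n,n}$ have weight $-2h$. -/

import Mathlib

open Finset

noncomputable section

/-!
Throughout, the complete bipartite graph `K_{n,n}` has the layers `α_1, …, α_n` and
`β_1, …, β_n`, both indexed by `Fin n`. Edge weights are a function `w : Fin n → Fin n → ℝ`, where
`w i j` is the weight of the edge `{α_i, β_j}`. A perfect matching is a permutation `M` of `Fin n`:
it consists of the edges `{α_i, β_{M i}}`.
-/

namespace BPMatching

/-- The same weighted graph with the two layers exchanged. -/
def swapLayers {n : ℕ} (w : Fin n → Fin n → ℝ) : Fin n → Fin n → ℝ := fun j i => w i j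

/-- The weight of the perfect matching `{α_i, β_{M i}}`. -/
def matchingWeight {n : ℕ} (w : Fin n → Fin n → ℝ) (M : Equiv.Perm (Fin n)) : ℝ :=
  ∑ i, w i (M i)

/-- The weight of a maximum weight perfect matching. -/
def optWeight {n : ℕ} (w : Fin n → Fin n → ℝ) : ℝ :=
  (Finset.univ : Finset (Equiv.Perm (Fin n))).sup' Finset.univ_nonempty (matchingWeight w)

/-- `ε` is the difference between the weights of the best and of the second best perfect
matching. -/
def IsUniquenessGap {n : ℕ} (w : Fin n → Fin n → ℝ) (ε : ℝ) : Prop :=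
  ∃ M M' : Equiv.Perm (Fin n), M' ≠ M ∧
    matchingWeight w M - matchingWeight w M' = ε ∧
    matchingWeight w M' ≤ matchingWeight w M ∧
    ∀ M'' : Equiv.Perm (Fin n), M'' ≠ M → matchingWeight w M'' ≤ matchingWeight w M'

/-- The messages of max-sum belief propagation. Every node `u` carries a variable whose value is the
partner of `u`. The edge `{α_i, β_j}` carries a factor which forbids that exactly one of its
endpoints chooses the other one, and which contributes `w i j` if both endpoints choose each other
and `0` if neither does.

`message w t i j r` is the message sent in iteration `t` from `α_i` to `β_j` about the event that
the partner of `β_j` is `α_r`: the maximum, over all choices `β_s` for the partner of `α_i` that the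
edge `{α_i, β_j}` does not forbid, of the contribution of this edge plus the messages that `α_i`
received in the preceding iteration from its neighbours other than `β_j`. Initially all messages are
zero. The message from `β_j` to `α_i` about `α_i` being matched with `β_s` is
`message (swapLayers w) t j i s`. -/
def message {n : ℕ} (w : Fin n → Fin n → ℝ) : ℕ → Fin n → Fin n → Fin n → ℝ
  | 0, _, _, _ => 0
  | t + 1, i, j, r =>
      ⨆ s : {s : Fin n // s = j ↔ r = i},
        ((if s.1 = j then w i j else 0) +
          ∑ l ∈ Finset.univ.erase j, message (swapLayers w) t l i s.1)

/-- The belief value (max-marginal) which the node `α_i` assigns in iteration `t` to the edge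
`{α_i, β_s}`: the sum of all messages that `α_i` receives in iteration `t`. -/
def beliefValue {n : ℕ} (w : Fin n → Fin n → ℝ) (t : ℕ) (i s : Fin n) : ℝ :=
  ∑ l, message (swapLayers w) t l i s

/-- In iteration `t` the node `α_i` may output the edge `{α_i, β_s}` as its belief: this edge
maximizes the belief value. If the maximizer is not unique, ties are broken arbitrarily. -/
def IsBelief {n : ℕ} (w : Fin n → Fin n → ℝ) (t : ℕ) (i s : Fin n) : Prop :=
  ∀ s' : Fin n, beliefValue w t i s' ≤ beliefValue w t i s

/-- The perfect matching `M` is a completion of a partial BP matching of iteration `t`: for some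
beliefs `{α_i, β_{bA i}}` and `{α_{bB j}, β_j}` of the nodes, `M` contains every edge for which the
beliefs of both endpoints agree. -/
def IsCompletion {n : ℕ} (w : Fin n → Fin n → ℝ) (t : ℕ) (M : Equiv.Perm (Fin n)) : Prop :=
  ∃ bA bB : Fin n → Fin n,
    (∀ i, IsBelief w t i (bA i)) ∧ (∀ j, IsBelief (swapLayers w) t j (bB j)) ∧
    ∀ i j, bA i = j → bB j = i → M i = j

/-- `c` node-disjoint cycles in `K_{n,n}` whose half-lengths are distinct primes in the open interval
`(n/(2c), n/c)`. The `i`-th cycle consists of the nodes `α_k` and `β_k` with `k = node i j`,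
`j = 0, …, len i - 1`. Its edges are `{α_k, β_k}` for each such `k`, the edges that join the
`α`-node at position `j + 1` to the `β`-node at position `j`, and the closing edge that joins the
`α`-node at position `0` to the `β`-node at position `len i - 1`. -/
structure PrimeCycles (n c : ℕ) where
  /-- the half-lengths -/
  len : Fin c → ℕ
  prime : ∀ i, (len i).Prime
  strictMono : StrictMono len
  lower : ∀ i, (n : ℝ) / (2 * c) < len i
  upper : ∀ i, (len i : ℝ) < n / c
  /-- the positions of the nodes -/
  node : (i : Fin c) → Fin (len i) → Fin n
  disjoint : ∀ i j i' j', node i j = node i' j' → i = i' ∧ (j : ℕ) = (j' : ℕ)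

/-- `{α_k, β_l}` is a suboptimal edge of the `i`-th cycle, other than its closing edge. -/
def PrimeCycles.IsSubEdge {n c : ℕ} (C : PrimeCycles n c) (i : Fin c) (k l : Fin n) : Prop :=
  ∃ j j' : Fin (C.len i), (j' : ℕ) = (j : ℕ) + 1 ∧ k = C.node i j' ∧ l = C.node i j

/-- `{α_k, β_l}` is the closing edge of the `i`-th cycle. -/
def PrimeCycles.IsHeavyEdge {n c : ℕ} (C : PrimeCycles n c) (i : Fin c) (k l : Fin n) : Prop :=
  ∃ j j' : Fin (C.len i), (j' : ℕ) = 0 ∧ (j : ℕ) + 1 = C.len i ∧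
    k = C.node i j' ∧ l = C.node i j

/-- The weights of the disjoint union of the cycles `C`, embedded in `K_{n,n}`, with heavy weight
`h`: all edges `{α_k, β_k}` (the optimal cycle edges, and a matching on the nodes outside the
cycles) weigh `h/2`, the closing edges `h`, and the other cycle edges slightly less than `h/2`, such
that the two perfect matchings of each cycle differ by exactly `ε`. All other edges weigh
`-2h`. -/
structure PrimeCycles.IsWeight {n c : ℕ} (C : PrimeCycles n c) (h ε : ℝ)
    (w : Fin n → Fin n → ℝ) : Prop where
  opt : ∀ k, w k k = h / 2
  sub : ∀ i k l, C.IsSubEdge i k l →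
    w k l = h / 2 - h / (2 * ((C.len i : ℝ) - 1)) - ε / ((C.len i : ℝ) - 1)
  heavy : ∀ i k l, C.IsHeavyEdge i k l → w k l = h
  light : ∀ k l, k ≠ l → (∀ i, ¬ C.IsSubEdge i k l ∧ ¬ C.IsHeavyEdge i k l) → w k l = -(2 * h)

end BPMatching

end

open Finset

noncomputable section

namespace BPMatching

/-! ### Reduction of messages to scalars -/

/-! A message depends on its argument only through whether the sender is chosen
(`exists_message_eq`). The difference of the two values, the advantage, satisfies a scalar
recursion: the edge weight minus the largest advantage arriving over another edge. As long as `t *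
ε` is small against `h`, a light edge never attains this maximum at a cycle node, so messages there
stay on their cycle (`CycleSystem.messageShape`). Comparing the two cycle edges at a node then
amounts to the sign of a sum of losses over `t` consecutive suboptimal edges around it
(`CycleSystem.incoming_difference`). Each full turn contributes only `ε`. The sign is decided by the
remaining `r = t % L` edges: it is negative exactly when they include the heavy edge. Hence `r`
consecutive nodes of each layer prefer their suboptimal edge and the others their optimal one.
Unless `r` is 0 or takes one extreme value depending on the parity of `t` (`IsSettled`), both kinds
of edges get agreed upon. No completion can then use only cycle edges at the α-nodes of this cycle,
because it would have to be entirely optimal or entirely suboptimal there. A light edge is forced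
and the cycle loses at least `2 * h`. Conversely, the beliefs leave at most one α-node per cycle
undecided, so no cycle loses more than `4 * h`. A settled half-length divides `t * (t - 1)` or `t *
(t + 1)`. The half-lengths are distinct primes, so their product is at most `2 * t ^ 2`, and for `t`
in the given range only a small fraction of the cycles is settled (`LargeScale.card_settled_le`).
With `s = √(n / log n)` the loss is therefore of order `h * s`, against an optimum `n * h / 2`,
where `n = s ^ 2 * log n`. Enough primes are supplied by Erdős's analysis of the central binomial
coefficient (`LargeScale.le_card_upperPrimes`). -/

/-- The amount by which a message favours the event that the sender is the partner of the
recipient. -/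
def advantage {n : ℕ} (w : Fin n → Fin n → ℝ) : ℕ → Fin n → Fin n → ℝ
  | 0, _, _ => 0
  | t + 1, i, j => w i j - ⨆ s : {s : Fin n // s ≠ j}, advantage (swapLayers w) t s.1 i

theorem sum_add_ite {n : ℕ} (S : Finset (Fin n)) (f g : Fin n → ℝ) (s : Fin n) (hs : s ∈ S) :
    ∑ l ∈ S, (f l + if s = l then g l else 0) = ∑ l ∈ S, f l + g s := by
  rw [Finset.sum_add_distrib, Finset.sum_ite_eq, if_pos hs]

/-- The edge constraint sees `r` only through `r = i`. If it holds, `s = j` is forced and no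
incoming advantage enters; otherwise `s ≠ j` and exactly one enters, whose maximum is absorbed into
`K`. -/
theorem exists_message_eq {n : ℕ} (hn : 2 ≤ n) (t : ℕ) : ∀ w : Fin n → Fin n → ℝ,
    ∃ K : Fin n → Fin n → ℝ, ∀ i j r,
      message w t i j r = K i j + if r = i then advantage w t i j else 0 := by
  induction t with
  | zero => exact fun w => ⟨fun _ _ => 0, fun i j r => by simp [message, advantage]⟩
  | succ t ih =>
    intro w
    obtain ⟨K, hK⟩ := ih (swapLayers w)
    have : Nontrivial (Fin n) := Fin.nontrivial_iff_two_le.2 hn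
    have hne : ∀ j : Fin n, Nonempty {s : Fin n // s ≠ j} := fun j =>
      let ⟨s, hs⟩ := exists_ne j; ⟨⟨s, hs⟩⟩
    refine ⟨fun i j => ∑ l ∈ univ.erase j, K l i +
      ⨆ s : {s : Fin n // s ≠ j}, advantage (swapLayers w) t s.1 i, fun i j r => ?_⟩
    simp only [message, hK]
    by_cases hr : r = i
    · have huniq : ∀ s : {s : Fin n // s = j ↔ r = i}, s.1 = j := fun s => s.2.2 hr
      have : Nonempty {s : Fin n // s = j ↔ r = i} := ⟨⟨j, by simp [hr]⟩⟩
      have hc : ∀ s : {s : Fin n // s = j ↔ r = i},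
          ((if s.1 = j then w i j else 0) + ∑ l ∈ univ.erase j,
            (K l i + if s.1 = l then advantage (swapLayers w) t l i else 0))
          = w i j + ∑ l ∈ univ.erase j, K l i := by
        intro s
        rw [if_pos (huniq s)]
        congr 1
        refine Finset.sum_congr rfl fun l hl => ?_
        rw [if_neg, add_zero]
        rw [huniq s]
        exact (Finset.ne_of_mem_erase hl).symm
      simp only [hc, ciSup_const, if_pos hr, advantage]
      ring
    · have hc : ∀ s : {s : Fin n // s = j ↔ r = i},
          ((if s.1 = j then w i j else 0) + ∑ l ∈ univ.erase j,
            (K l i + if s.1 = l then advantage (swapLayers w) t l i else 0))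
          = ∑ l ∈ univ.erase j, K l i + advantage (swapLayers w) t s.1 i := by
        intro s
        have hs : s.1 ≠ j := fun h => hr (s.2.1 h)
        rw [if_neg hs, zero_add, sum_add_ite _ _ (fun l => advantage (swapLayers w) t l i)]
        exact Finset.mem_erase.2 ⟨hs, mem_univ _⟩
      simp only [hc, if_neg hr, add_zero]
      have := hne j
      let e : {s : Fin n // s = j ↔ r = i} ≃ {s : Fin n // s ≠ j} :=
        Equiv.subtypeEquivRight fun s => by simp [hr]
      rw [← Equiv.iSup_comp (g := fun s : {s : Fin n // s ≠ j} =>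
        advantage (swapLayers w) t s.1 i) e]
      have : Nonempty {s : Fin n // s = j ↔ r = i} := ⟨e.symm (Classical.arbitrary _)⟩
      exact (add_ciSup (Set.finite_range _).bddAbove _).symm

theorem isBelief_iff {n : ℕ} (hn : 2 ≤ n) (w : Fin n → Fin n → ℝ) (t : ℕ) (i s : Fin n) :
    IsBelief w t i s ↔
      ∀ s', advantage (swapLayers w) t s' i ≤ advantage (swapLayers w) t s i := by
  obtain ⟨K, hK⟩ := exists_message_eq hn t (swapLayers w)
  have h : ∀ s, beliefValue w t i s = ∑ l, K l i + advantage (swapLayers w) t s i := by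
    intro s
    simp only [beliefValue, hK]
    exact sum_add_ite _ _ (fun l => advantage (swapLayers w) t l i) s (mem_univ _)
  simp only [IsBelief, h, add_le_add_iff_left]

theorem advantage_one {n : ℕ} (w : Fin n → Fin n → ℝ) (i j : Fin n) :
    advantage w 1 i j = w i j := by
  simp [advantage]

theorem advantage_succ_eq {n : ℕ} (w : Fin n → Fin n → ℝ) (t : ℕ) {i j s : Fin n} (hs : s ≠ j)
    (hmax : ∀ s', s' ≠ j → advantage (swapLayers w) t s' i ≤ advantage (swapLayers w) t s i) :
    advantage w (t + 1) i j = w i j - advantage (swapLayers w) t s i := by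
  have : Nonempty {s : Fin n // s ≠ j} := ⟨⟨s, hs⟩⟩
  rw [advantage]
  congr 1
  exact le_antisymm (ciSup_le fun s' => hmax s'.1 s'.2)
    (le_ciSup (f := fun s' : {s : Fin n // s ≠ j} => advantage (swapLayers w) t s'.1 i)
      (Set.finite_range _).bddAbove ⟨s, hs⟩)

theorem advantage_succ_le {n : ℕ} (w : Fin n → Fin n → ℝ) (t : ℕ) {i j s : Fin n} (hs : s ≠ j) :
    advantage w (t + 1) i j ≤ w i j - advantage (swapLayers w) t s i := by
  rw [advantage]
  exact sub_le_sub_left (le_ciSup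
    (f := fun s' : {s : Fin n // s ≠ j} => advantage (swapLayers w) t s'.1 i)
    (Set.finite_range _).bddAbove ⟨s, hs⟩) _

theorem le_advantage_succ {n : ℕ} (hn : 2 ≤ n) (w : Fin n → Fin n → ℝ) (t : ℕ) {i j : Fin n}
    {B : ℝ} (hB : ∀ s, s ≠ j → advantage (swapLayers w) t s i ≤ B) :
    w i j - B ≤ advantage w (t + 1) i j := by
  have : Nontrivial (Fin n) := Fin.nontrivial_iff_two_le.2 hn
  obtain ⟨s, hs⟩ := exists_ne j
  have : Nonempty {s : Fin n // s ≠ j} := ⟨⟨s, hs⟩⟩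
  rw [advantage]
  exact sub_le_sub_left (ciSup_le fun s' : {s : Fin n // s ≠ j} => hB s'.1 s'.2) _

/-! ### Alternating sums along a cycle -/

/-- The amount by which the weight of the suboptimal edge at position `j` of a cycle of half-length
`L` falls short of that of an optimal edge. -/
def edgeLoss (h ε : ℝ) (L : ℕ) (j : ℤ) : ℝ :=
  if (L : ℤ) ∣ j then -(h / 2) else (h / 2 + ε) / ((L : ℝ) - 1)

/-- The total loss of `m` consecutive suboptimal edges, counted backwards from position `j`. -/
def lossSum (h ε : ℝ) (L : ℕ) (j : ℤ) (m : ℕ) : ℝ :=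
  ∑ i ∈ range m, edgeLoss h ε L (j - i)

theorem edgeLoss_neg (h ε : ℝ) (L : ℕ) (j : ℤ) : edgeLoss h ε L (-j) = edgeLoss h ε L j := by
  simp [edgeLoss]

theorem lossSum_succ' (h ε : ℝ) (L : ℕ) (j : ℤ) (m : ℕ) :
    lossSum h ε L j (m + 1) = edgeLoss h ε L j + lossSum h ε L (j - 1) m := by
  rw [lossSum, Finset.sum_range_succ', add_comm]
  simp only [lossSum, Nat.cast_zero, sub_zero, Nat.cast_add, Nat.cast_one]
  congr 1
  exact Finset.sum_congr rfl fun i _ => by congr 1; ring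

theorem lossSum_add (h ε : ℝ) (L : ℕ) (j : ℤ) (m k : ℕ) :
    lossSum h ε L j (m + k) = lossSum h ε L j m + lossSum h ε L (j - m) k := by
  rw [lossSum, Finset.sum_range_add]
  simp only [lossSum]
  congr 1
  exact Finset.sum_congr rfl fun i _ => by congr 1; push_cast; ring

/-- The heavy edge sits at position 0, so the loss is an even function of the position and a window
may be mirrored. -/
theorem lossSum_reflect (h ε : ℝ) (L : ℕ) (j : ℤ) (m : ℕ) :
    lossSum h ε L (-j) m = lossSum h ε L (j + m - 1) m := by
  rw [lossSum, ← Finset.sum_range_reflect]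
  simp only [lossSum]
  refine Finset.sum_congr rfl fun i hi => ?_
  rw [← edgeLoss_neg]
  have := Finset.mem_range.1 hi
  congr 1
  omega

theorem int_sub_one_ediv {L : ℕ} (hL : 2 ≤ L) (k : ℤ) :
    (k - 1) / (L : ℤ) = k / L - if (L : ℤ) ∣ k then 1 else 0 := by
  have hL' : (2 : ℤ) ≤ L := by exact_mod_cast hL
  split_ifs with hk
  · obtain ⟨a, rfl⟩ := hk
    rw [Int.mul_ediv_cancel_left _ (by omega)]
    rw [Int.ediv_eq_iff_of_pos (by omega)]
    constructor <;> nlinarith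
  · have h1 := Int.emod_add_mul_ediv k L
    have h2 := Int.emod_nonneg k (b := (L : ℤ)) (by omega)
    have h3 := Int.emod_lt_of_pos k (b := (L : ℤ)) (by omega)
    have h4 : k % L ≠ 0 := fun h0 => hk (Int.dvd_of_emod_eq_zero h0)
    have h5 : 0 < k % L := by omega
    rw [sub_zero, Int.ediv_eq_iff_of_pos (by omega)]
    constructor <;> nlinarith

/-- A heavy edge differs from an ordinary one by `L * d - ε`, where `d` is the ordinary loss; the
difference of quotients counts the heavy edges in the window. -/
theorem lossSum_eq {h ε : ℝ} {L : ℕ} (hL : 2 ≤ L) (j : ℤ) (m : ℕ) :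
    lossSum h ε L j m = m * ((h / 2 + ε) / ((L : ℝ) - 1)) -
      (L * ((h / 2 + ε) / ((L : ℝ) - 1)) - ε) * ((j / L - (j - m) / L : ℤ) : ℝ) := by
  have hL1 : (L : ℝ) - 1 ≠ 0 := by
    have : (2 : ℝ) ≤ L := by exact_mod_cast hL
    linarith
  induction m with
  | zero => simp [lossSum]
  | succ m ih =>
    have h1 : lossSum h ε L j (m + 1) = lossSum h ε L j m + edgeLoss h ε L (j - m) := by
      rw [lossSum, Finset.sum_range_succ]; rfl
    have h2 : (j - ((m + 1 : ℕ) : ℤ)) = (j - m) - 1 := by push_cast; ring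
    rw [h1, ih, h2, int_sub_one_ediv hL, edgeLoss]
    split_ifs with hd
    · push_cast
      field_simp
      ring
    · push_cast
      ring

theorem sub_ediv_eq {L : ℕ} (hL : 2 ≤ L) (j : ℤ) (m : ℕ) :
    j / L - (j - m) / L = (m / L : ℕ) + if j % L < (m % L : ℕ) then 1 else 0 := by
  have hL' : (2 : ℤ) ≤ L := by exact_mod_cast hL
  have h1 := Int.emod_add_mul_ediv j L
  have h2 := Int.emod_nonneg j (b := (L : ℤ)) (by omega)
  have h3 := Int.emod_lt_of_pos j (b := (L : ℤ)) (by omega)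
  have h4 : ((m % L : ℕ) : ℤ) + L * (m / L : ℕ) = m := by exact_mod_cast Nat.mod_add_div m L
  have h5 : ((m % L : ℕ) : ℤ) < L := by exact_mod_cast Nat.mod_lt _ (by omega)
  have key : (j - m) / (L : ℤ) =
      j / L - (m / L : ℕ) - if j % L < (m % L : ℕ) then 1 else 0 := by
    rw [Int.ediv_eq_iff_of_pos (by omega)]
    split_ifs <;> constructor <;> nlinarith
  rw [key]; ring

/-- Each of the `m / L` full turns contributes `ε`. If the remainder contains the heavy edge, it is
a full turn with `L - m % L` ordinary edges missing. -/
theorem lossSum_formula {h ε : ℝ} {L : ℕ} (hL : 2 ≤ L) (j : ℤ) (m : ℕ) :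
    lossSum h ε L j m = if j % L < (m % L : ℕ)
      then ((m / L : ℕ) + 1) * ε - (L - (m % L : ℕ)) * ((h / 2 + ε) / ((L : ℝ) - 1))
      else (m / L : ℕ) * ε + (m % L : ℕ) * ((h / 2 + ε) / ((L : ℝ) - 1)) := by
  have h4 : (m : ℝ) = (m % L : ℕ) + L * (m / L : ℕ) := by exact_mod_cast (Nat.mod_add_div m L).symm
  rw [lossSum_eq hL, sub_ediv_eq hL]
  generalize (h / 2 + ε) / ((L : ℝ) - 1) = d
  generalize m / L = q at *
  generalize m % L = r at *
  rw [h4]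
  split_ifs <;> push_cast <;> ring

/-! ### Size and sign of window sums -/

section bounds

variable {h ε : ℝ} {L : ℕ}

theorem sub_one_mul_edgeLoss (hL : 2 ≤ L) :
    ((L : ℝ) - 1) * ((h / 2 + ε) / ((L : ℝ) - 1)) = h / 2 + ε := by
  have : (2 : ℝ) ≤ L := by exact_mod_cast hL
  field_simp [show (L : ℝ) - 1 ≠ 0 by linarith]

theorem edgeLoss_pos (hh : 0 < h) (hε : 0 < ε) (hL : 2 ≤ L) :
    0 < (h / 2 + ε) / ((L : ℝ) - 1) := by
  have : (2 : ℝ) ≤ L := by exact_mod_cast hL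
  apply div_pos <;> linarith

theorem neg_le_lossSum (hh : 0 < h) (hε : 0 < ε) (hL : 2 ≤ L) (j : ℤ) (m : ℕ) :
    -(h / 2) ≤ lossSum h ε L j m := by
  rw [lossSum_formula hL]
  have hd := edgeLoss_pos hh hε hL
  have hd' := sub_one_mul_edgeLoss (h := h) (ε := ε) hL
  have hq : (0 : ℝ) ≤ (m / L : ℕ) := Nat.cast_nonneg _
  have hr : (0 : ℝ) ≤ (m % L : ℕ) := Nat.cast_nonneg _
  split_ifs with hj
  · have h2 := Int.emod_nonneg j (b := (L : ℤ)) (by omega)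
    have h1 : (1 : ℝ) ≤ (m % L : ℕ) := by
      have : 1 ≤ m % L := by omega
      exact_mod_cast this
    nlinarith
  · nlinarith [mul_nonneg hq hε.le, mul_nonneg hr hd.le]

theorem lossSum_le (hh : 0 < h) (hε : 0 < ε) (hL : 2 ≤ L) (j : ℤ) (m : ℕ) :
    lossSum h ε L j m ≤ h / 2 + ((m / L : ℕ) + 1) * ε := by
  rw [lossSum_formula hL]
  have hd := edgeLoss_pos hh hε hL
  have hd' := sub_one_mul_edgeLoss (h := h) (ε := ε) hL
  have hr : ((m % L : ℕ) : ℝ) + 1 ≤ L := by exact_mod_cast Nat.mod_lt m (by omega : L > 0)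
  split_ifs with hj
  · nlinarith
  · nlinarith

theorem succ_div_mul_le (hε : 0 < ε) (m t : ℕ) (hmt : m ≤ t) :
    ((m / L : ℕ) + 1 : ℝ) * (L * ε) ≤ ((t : ℝ) + L) * ε := by
  have : ((m / L : ℕ) : ℝ) * L ≤ t := by
    exact_mod_cast (Nat.div_mul_le_self m L).trans hmt
  nlinarith

theorem lossSum_le_of_small (hh : 0 < h) (hε : 0 < ε) (hL : 2 ≤ L) {t : ℕ}
    (ht : ((t : ℝ) + L) * ε ≤ h / 4) (j : ℤ) {m : ℕ} (hm : m ≤ t) :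
    lossSum h ε L j m ≤ 3 * h / 4 := by
  have h1 := lossSum_le hh hε hL j m
  have h2 := succ_div_mul_le (L := L) hε m t hm
  have hL' : (2 : ℝ) ≤ L := by exact_mod_cast hL
  have hq : (0 : ℝ) ≤ (m / L : ℕ) := Nat.cast_nonneg _
  nlinarith [mul_nonneg hq hε.le]

/-- At least one ordinary edge is missing from the last turn, and its loss outweighs all the gaps
`ε` accumulated so far, since `(t / L + 1) * L * ε ≤ h / 4`. -/
theorem lossSum_neg_of_lt (hh : 0 < h) (hε : 0 < ε) (hL : 2 ≤ L) {t : ℕ}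
    (ht : ((t : ℝ) + L) * ε ≤ h / 4) {j : ℤ} (hj : j % L < (t % L : ℕ)) :
    lossSum h ε L j t < 0 := by
  have hL' : (2 : ℝ) ≤ L := by exact_mod_cast hL
  have hd := edgeLoss_pos hh hε hL
  have hd' := sub_one_mul_edgeLoss (h := h) (ε := ε) hL
  have h2 := succ_div_mul_le (L := L) hε t t le_rfl
  have hr : ((t % L : ℕ) : ℝ) + 1 ≤ L := by exact_mod_cast Nat.mod_lt t (by omega : L > 0)
  rw [lossSum_formula hL, if_pos hj]
  set d := (h / 2 + ε) / ((L : ℝ) - 1)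
  have h3 : d ≤ (L - (t % L : ℕ)) * d := by nlinarith
  have h4 : ((t / L : ℕ) + 1) * ε < d := by
    have : ((t / L : ℕ) + 1) * ε * L < d * L := by nlinarith
    exact lt_of_mul_lt_mul_right this (by linarith)
  linarith

theorem lossSum_pos_of_le (hh : 0 < h) (hε : 0 < ε) (hL : 2 ≤ L) {t : ℕ} (ht : 1 ≤ t) {j : ℤ}
    (hj : ((t % L : ℕ) : ℤ) ≤ j % L) : 0 < lossSum h ε L j t := by
  have hd := edgeLoss_pos hh hε hL
  rw [lossSum_formula hL, if_neg (not_lt.2 hj)]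
  rcases Nat.eq_zero_or_pos (t % L) with h0 | h0
  · have : 0 < t / L := by
      rcases Nat.eq_zero_or_pos (t / L) with h1 | h1
      · have := Nat.mod_add_div t L
        rw [h0, h1] at this
        omega
      · exact h1
    have : (0 : ℝ) < (t / L : ℕ) := by exact_mod_cast this
    rw [h0]
    simp only [Nat.cast_zero, zero_mul, add_zero]
    positivity
  · have : (0 : ℝ) < (t % L : ℕ) := by exact_mod_cast h0
    positivity

end bounds

/-! ### Disjoint cycles, parametrized periodically by the integers -/

/-- The edge `{α_k, β_l}` is neither of the form `{α_k, β_k}` nor on one of the cycles `p i`. -/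
def IsLight {n : ℕ} {ι : Type*} (p : ι → ℤ → Fin n) (k l : Fin n) : Prop :=
  k ≠ l ∧ ∀ i j, k = p i j → l ≠ p i (j - 1)

/-- Disjoint cycles of half-lengths `L i` whose nodes `p i j` are indexed modulo `L i`, with the
weights of `PrimeCycles.IsWeight`. -/
structure CycleSystem {n : ℕ} {ι : Type*} (w : Fin n → Fin n → ℝ) (h ε : ℝ) (L : ι → ℕ)
    (p : ι → ℤ → Fin n) : Prop where
  two_le : ∀ i, 2 ≤ L i
  node_eq : ∀ i i' j j', p i j = p i' j' ↔ i = i' ∧ (L i : ℤ) ∣ j - j'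
  opt : ∀ k, w k k = h / 2
  sub : ∀ i j, w (p i j) (p i (j - 1)) = h / 2 - edgeLoss h ε (L i) j
  light : ∀ k l, IsLight p k l → w k l = -(2 * h)

/-- The parametrization of the cycles after exchanging the layers. -/
def reflectNodes {n : ℕ} {ι : Type*} (p : ι → ℤ → Fin n) : ι → ℤ → Fin n :=
  fun i j => p i (-1 - j)

theorem IsLight.reflect {n : ℕ} {ι : Type*} {p : ι → ℤ → Fin n} {k l : Fin n}
    (hkl : IsLight p k l) : IsLight (reflectNodes p) l k := by
  refine ⟨hkl.1.symm, fun i j hl hk => hkl.2 i (-j) ?_ ?_⟩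
  · rw [hk, reflectNodes]; congr 1; ring
  · rw [hl, reflectNodes]; congr 1; ring

theorem reflectNodes_reflectNodes {n : ℕ} {ι : Type*} (p : ι → ℤ → Fin n) :
    reflectNodes (reflectNodes p) = p := by
  funext i j
  simp [reflectNodes]

/-- In iteration `t`, the node `α_j` of a cycle prefers the suboptimal edge. -/
def PrefersSub (L t : ℕ) (j : ℤ) : Prop := (j + (t / 2 : ℕ)) % L < (t % L : ℕ)

/-- In iteration `t`, the node `β_j` of a cycle prefers the suboptimal edge. -/
def PrefersSub' (L t : ℕ) (j : ℤ) : Prop := (j + ((t + 1) / 2 : ℕ)) % L < (t % L : ℕ)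

/-- The two window positions add up to `t - 1`, and `x ↦ t - 1 - x` preserves the residues below `t
% L`. -/
theorem prefersSub_reflect {L : ℕ} (hL : 2 ≤ L) (t : ℕ) (j : ℤ) :
    PrefersSub L t (-1 - j) ↔ PrefersSub' L t j := by
  have main : ∀ x y : ℤ, x + y = t - 1 → x % L < (t % L : ℕ) → y % L < (t % L : ℕ) := by
    intro x y hxy hx
    have h1 := Int.emod_add_mul_ediv x L
    have h2 := Int.emod_nonneg x (b := (L : ℤ)) (by omega)
    have h4 : ((t % L : ℕ) : ℤ) + L * (t / L : ℕ) = t := by exact_mod_cast Nat.mod_add_div t L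
    have h5 : ((t % L : ℕ) : ℤ) < L := by exact_mod_cast Nat.mod_lt _ (by omega)
    have hy : y = ((t % L : ℕ) - 1 - x % L) + L * ((t / L : ℕ) - x / L) := by linarith
    rw [hy, Int.add_mul_emod_self_left, Int.emod_eq_of_lt] <;> omega
  unfold PrefersSub PrefersSub'
  constructor <;> apply main <;> omega

namespace CycleSystem

variable {n : ℕ} {ι : Type*} {w : Fin n → Fin n → ℝ} {h ε : ℝ} {L : ι → ℕ} {p : ι → ℤ → Fin n}

/-- Reversing the orientation turns the edge at position `j` into the one at `-j`, which has the
same loss. Statements about β-nodes thus follow from those about α-nodes. -/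
theorem reflect (S : CycleSystem w h ε L p) :
    CycleSystem (swapLayers w) h ε L (reflectNodes p) where
  two_le := S.two_le
  node_eq i i' j j' := by
    rw [reflectNodes, reflectNodes, S.node_eq, ← dvd_neg]
    congr! 2
    ring
  opt := S.opt
  sub i j := by
    have h1 : reflectNodes p i (j - 1) = p i (-j) := by rw [reflectNodes]; congr 1; ring
    have h2 : reflectNodes p i j = p i (-j - 1) := by rw [reflectNodes]; congr 1; ring
    rw [h1, h2, swapLayers, S.sub, edgeLoss_neg]
  light k l hkl := S.light l k (by simpa only [reflectNodes_reflectNodes] using hkl.reflect)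

theorem node_sub_one (S : CycleSystem w h ε L p) {i i' : ι} {j j' : ℤ} (he : p i j = p i' j') :
    p i (j - 1) = p i' (j' - 1) := by
  rw [S.node_eq] at he ⊢
  refine ⟨he.1, ?_⟩
  rw [show j - 1 - (j' - 1) = j - j' by ring]
  exact he.2

theorem node_sub_one_ne (S : CycleSystem w h ε L p) (i : ι) (j : ℤ) : p i (j - 1) ≠ p i j := by
  intro he
  have h1 := ((S.node_eq _ _ _ _).1 he).2
  rw [show j - 1 - j = -1 by ring, dvd_neg] at h1
  have h2 := Int.le_of_dvd one_pos h1
  have := S.two_le i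
  omega

theorem isLight_iff (S : CycleSystem w h ε L p) (i : ι) (j : ℤ) (l : Fin n) :
    IsLight p (p i j) l ↔ l ≠ p i j ∧ l ≠ p i (j - 1) := by
  constructor
  · exact fun hl => ⟨hl.1.symm, hl.2 i j rfl⟩
  · refine fun hl => ⟨hl.1.symm, fun i' j' he => ?_⟩
    rw [← S.node_sub_one he]
    exact hl.2

/-! ### The messages on a system of cycles -/

/-- The shape of the messages in iteration `t`. -/
structure MessageShape (w : Fin n → Fin n → ℝ) (h ε : ℝ) (L : ι → ℕ) (p : ι → ℤ → Fin n)
    (t : ℕ) : Prop where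
  opt : ∀ i j, advantage w t (p i j) (p i j) =
    (t % 2 : ℕ) * (h / 2) + lossSum h ε (L i) j (t / 2)
  sub : ∀ i j, advantage w t (p i j) (p i (j - 1)) =
    (t % 2 : ℕ) * (h / 2) - lossSum h ε (L i) (-j) ((t + 1) / 2)
  isolated : ∀ k, (∀ i j, k ≠ p i j) → h / 2 ≤ advantage w t k k
  light : ∀ k l, IsLight p k l → advantage w t k l ≤ -(5 * h / 4)

/-! ### Messages arriving at an α-node -/

section incoming

variable {t : ℕ} (P : MessageShape (swapLayers w) h ε L (reflectNodes p) t)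
include P

theorem MessageShape.incoming_opt (i : ι) (j : ℤ) :
    advantage (swapLayers w) t (p i j) (p i j) =
      (t % 2 : ℕ) * (h / 2) + lossSum h ε (L i) (-1 - j) (t / 2) := by
  have := P.opt i (-1 - j)
  rwa [reflectNodes, show -1 - (-1 - j) = j by ring] at this

theorem MessageShape.incoming_sub (i : ι) (j : ℤ) :
    advantage (swapLayers w) t (p i (j - 1)) (p i j) =
      (t % 2 : ℕ) * (h / 2) - lossSum h ε (L i) j ((t + 1) / 2) := by
  have := P.sub i (-j)
  rwa [reflectNodes, reflectNodes, show -1 - -j = j - 1 by ring,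
    show -1 - (-j - 1) = j by ring, neg_neg] at this

theorem MessageShape.incoming_light {k l : Fin n} (hkl : IsLight p k l) :
    advantage (swapLayers w) t l k ≤ -(5 * h / 4) := P.light l k hkl.reflect

theorem MessageShape.incoming_isolated {k : Fin n} (hk : ∀ i j, k ≠ p i j) :
    h / 2 ≤ advantage (swapLayers w) t k k := P.isolated k fun i _ => hk i _

theorem MessageShape.le_incoming_opt (hh : 0 < h) (hε : 0 < ε) (S : CycleSystem w h ε L p)
    (i : ι) (j : ℤ) : -(3 * h / 4) ≤ advantage (swapLayers w) t (p i j) (p i j) := by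
  rw [P.incoming_opt]
  have := neg_le_lossSum hh hε (S.two_le i) (-1 - j) (t / 2)
  have : 0 ≤ ((t % 2 : ℕ) : ℝ) * (h / 2) := by positivity
  linarith

theorem MessageShape.le_incoming_sub (hh : 0 < h) (hε : 0 < ε) (S : CycleSystem w h ε L p)
    (ht : ∀ i, ((t : ℝ) + L i) * ε ≤ h / 4) (i : ι) (j : ℤ) :
    -(3 * h / 4) ≤ advantage (swapLayers w) t (p i (j - 1)) (p i j) := by
  rw [P.incoming_sub]
  have := lossSum_le_of_small hh hε (S.two_le i) (ht i) j (m := (t + 1) / 2) (by omega)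
  have : 0 ≤ ((t % 2 : ℕ) : ℝ) * (h / 2) := by positivity
  linarith

end incoming

theorem messageShape_one (S : CycleSystem w h ε L p) (hh : 0 < h) :
    MessageShape w h ε L p 1 where
  opt i j := by rw [advantage_one, S.opt]; simp [lossSum]
  sub i j := by rw [advantage_one, S.sub]; simp [lossSum, edgeLoss_neg]
  isolated k _ := by rw [advantage_one, S.opt]
  light k l hkl := by rw [advantage_one, S.light k l hkl]; linarith

/-- Incoming cycle messages are at least `-(3 * h / 4)`, light ones at most `-(5 * h / 4)`, so the
maximum is the other cycle edge and the alternating sum grows by one edge; the edge weights `h / 2`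
cancel in pairs, which gives the parity term. The light bound reproduces itself because `-2 * h + 3
* h / 4 = -(5 * h / 4)`. -/
theorem messageShape_succ (hn : 2 ≤ n) (hh : 0 < h) (hε : 0 < ε) {t : ℕ}
    (ht : ∀ i, ((t : ℝ) + L i) * ε ≤ h / 4) (S : CycleSystem w h ε L p)
    (P : MessageShape (swapLayers w) h ε L (reflectNodes p) t) :
    MessageShape w h ε L p (t + 1) := by
  refine ⟨fun i j => ?_, fun i j => ?_, fun k hk => ?_, fun k l hkl => ?_⟩
  · rw [advantage_succ_eq w t (S.node_sub_one_ne i j), S.opt, P.incoming_sub]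
    · rcases Nat.mod_two_eq_zero_or_one t with h0 | h0
      · rw [h0, show (t + 1) % 2 = 1 by omega]; push_cast; ring
      · rw [h0, show (t + 1) % 2 = 0 by omega]; push_cast; ring
    · intro s hs
      by_cases hs' : s = p i (j - 1)
      · rw [hs']
      · have h1 := P.incoming_light ((S.isLight_iff i j s).2 ⟨hs, hs'⟩)
        have h2 := P.le_incoming_sub hh hε S ht i j
        linarith
  · rw [advantage_succ_eq w t (S.node_sub_one_ne i j).symm, S.sub, P.incoming_opt,
      show (t + 1 + 1) / 2 = t / 2 + 1 by omega, lossSum_succ', edgeLoss_neg,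
      show -j - 1 = -1 - j by ring]
    · rcases Nat.mod_two_eq_zero_or_one t with h0 | h0
      · rw [h0, show (t + 1) % 2 = 1 by omega]; push_cast; ring
      · rw [h0, show (t + 1) % 2 = 0 by omega]; push_cast; ring
    · intro s hs
      by_cases hs' : s = p i j
      · rw [hs']
      · have h1 := P.incoming_light ((S.isLight_iff i j s).2 ⟨hs', hs⟩)
        have h2 := P.le_incoming_opt hh hε S i j
        linarith
  · have := le_advantage_succ hn w t (i := k) (j := k) (B := 0) fun s hs => by
      have := P.incoming_light (k := k) (l := s) ⟨hs.symm, fun i j he => absurd he (hk i j)⟩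
      linarith
    rw [S.opt] at this
    linarith
  · have h1 := advantage_succ_le w t (i := k) hkl.1
    rw [S.light k l hkl] at h1
    have h2 : -(3 * h / 4) ≤ advantage (swapLayers w) t k k := by
      by_cases hk : ∀ i j, k ≠ p i j
      · have := P.incoming_isolated hk
        linarith
      · push Not at hk
        obtain ⟨i, j, rfl⟩ := hk
        exact P.le_incoming_opt hh hε S i j
    linarith

/-- Weights and parametrization are quantified after `t` because every induction step exchanges the
layers. -/
theorem messageShape (hn : 2 ≤ n) (hh : 0 < h) (hε : 0 < ε) {t : ℕ} (ht1 : 1 ≤ t) :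
    ∀ {w : Fin n → Fin n → ℝ} {p : ι → ℤ → Fin n}, CycleSystem w h ε L p →
      (∀ i, ((t : ℝ) + L i) * ε ≤ h / 4) → MessageShape w h ε L p t := by
  induction t, ht1 using Nat.le_induction with
  | base => exact fun S _ => S.messageShape_one hh
  | succ t _ ih =>
    intro w p S ht
    have ht' : ∀ i, ((t : ℝ) + L i) * ε ≤ h / 4 := fun i => by
      have := ht i
      push_cast at this
      nlinarith
    exact messageShape_succ hn hh hε ht' S (ih S.reflect ht')

/-! ### Beliefs and completions on a system of cycles -/

section beliefs

variable {t : ℕ} (S : CycleSystem w h ε L p) (hn : 2 ≤ n) (hh : 0 < h) (hε : 0 < ε) (ht1 : 1 ≤ t)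
  (ht : ∀ i, ((t : ℝ) + L i) * ε ≤ h / 4)
include S hn hh hε ht1 ht

/-- The two arriving sums cover adjacent stretches of `t / 2` and `(t + 1) / 2` suboptimal edges on
either side of the node, which join into one window. -/
theorem incoming_difference (i : ι) (j : ℤ) :
    advantage (swapLayers w) t (p i j) (p i j) -
      advantage (swapLayers w) t (p i (j - 1)) (p i j) =
    lossSum h ε (L i) (j + (t / 2 : ℕ)) t := by
  have P := messageShape hn hh hε ht1 S.reflect ht
  have h1 := lossSum_add h ε (L i) (j + (t / 2 : ℕ)) (t / 2) ((t + 1) / 2)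
  rw [show t / 2 + (t + 1) / 2 = t by omega, add_sub_cancel_right] at h1
  rw [h1, P.incoming_opt, P.incoming_sub, show -1 - j = -(j + 1) by ring, lossSum_reflect,
    show j + 1 + ((t / 2 : ℕ) : ℤ) - 1 = j + (t / 2 : ℕ) by ring]
  ring

theorem eq_or_eq_of_isBelief {i : ι} {j : ℤ} {s : Fin n} (hs : IsBelief w t (p i j) s) :
    s = p i j ∨ s = p i (j - 1) := by
  have P := messageShape hn hh hε ht1 S.reflect ht
  by_contra! hne
  have h1 := P.incoming_light ((S.isLight_iff i j s).2 hne)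
  have h2 := P.le_incoming_opt hh hε S i j
  have h3 := (isBelief_iff hn w t _ s).1 hs (p i j)
  linarith

theorem belief_eq_of_prefersSub {i : ι} {j : ℤ} {s : Fin n} (hs : IsBelief w t (p i j) s)
    (hj : PrefersSub (L i) t j) : s = p i (j - 1) := by
  refine (S.eq_or_eq_of_isBelief hn hh hε ht1 ht hs).resolve_left ?_
  rintro rfl
  have h1 := S.incoming_difference hn hh hε ht1 ht i j
  have h2 := lossSum_neg_of_lt hh hε (S.two_le i) (ht i) hj
  have h3 := (isBelief_iff hn w t _ _).1 hs (p i (j - 1))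
  linarith

theorem belief_eq_of_not_prefersSub {i : ι} {j : ℤ} {s : Fin n} (hs : IsBelief w t (p i j) s)
    (hj : ¬ PrefersSub (L i) t j) : s = p i j := by
  refine (S.eq_or_eq_of_isBelief hn hh hε ht1 ht hs).resolve_right ?_
  rintro rfl
  have h1 := S.incoming_difference hn hh hε ht1 ht i j
  have h2 := lossSum_pos_of_le hh hε (S.two_le i) ht1 (not_lt.1 hj)
  have h3 := (isBelief_iff hn w t _ _).1 hs (p i j)
  linarith

theorem belief_eq_of_isolated {k s : Fin n} (hk : ∀ i j, k ≠ p i j) (hs : IsBelief w t k s) :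
    s = k := by
  have P := messageShape hn hh hε ht1 S.reflect ht
  by_contra! hne
  have h1 := P.incoming_light (k := k) (l := s) ⟨hne.symm, fun i j he => absurd he (hk i j)⟩
  have h2 := P.incoming_isolated hk
  have h3 := (isBelief_iff hn w t _ s).1 hs k
  linarith

theorem belief'_eq_of_prefersSub' {i : ι} {j : ℤ} {s : Fin n}
    (hs : IsBelief (swapLayers w) t (p i j) s) (hj : PrefersSub' (L i) t j) :
    s = p i (j + 1) := by
  have := S.reflect.belief_eq_of_prefersSub hn hh hε ht1 ht (i := i) (j := -1 - j) (s := s)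
    (by rwa [reflectNodes, show -1 - (-1 - j) = j by ring])
    ((prefersSub_reflect (S.two_le i) t j).2 hj)
  rwa [reflectNodes, show -1 - (-1 - j - 1) = j + 1 by ring] at this

theorem belief'_eq_of_not_prefersSub' {i : ι} {j : ℤ} {s : Fin n}
    (hs : IsBelief (swapLayers w) t (p i j) s) (hj : ¬ PrefersSub' (L i) t j) :
    s = p i j := by
  have := S.reflect.belief_eq_of_not_prefersSub hn hh hε ht1 ht (i := i) (j := -1 - j) (s := s)
    (by rwa [reflectNodes, show -1 - (-1 - j) = j by ring])
    (by rwa [prefersSub_reflect (S.two_le i) t j])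
  rwa [reflectNodes, show -1 - (-1 - j) = j by ring] at this

variable {M : Equiv.Perm (Fin n)} (hM : IsCompletion w t M)
include hM

theorem completion_isolated {k : Fin n} (hk : ∀ i j, k ≠ p i j) : M k = k := by
  obtain ⟨bA, bB, hA, hB, hAB⟩ := hM
  exact hAB k k (S.belief_eq_of_isolated hn hh hε ht1 ht hk (hA k))
    (S.reflect.belief_eq_of_isolated hn hh hε ht1 ht (fun i j => hk i _) (hB k))

theorem completion_opt {i : ι} {j : ℤ} (hj : ¬ PrefersSub (L i) t j)
    (hj' : ¬ PrefersSub' (L i) t j) : M (p i j) = p i j := by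
  obtain ⟨bA, bB, hA, hB, hAB⟩ := hM
  exact hAB _ _ (S.belief_eq_of_not_prefersSub hn hh hε ht1 ht (hA _) hj)
    (S.belief'_eq_of_not_prefersSub' hn hh hε ht1 ht (hB _) hj')

theorem completion_sub {i : ι} {j : ℤ} (hj : PrefersSub (L i) t j)
    (hj' : PrefersSub' (L i) t (j - 1)) : M (p i j) = p i (j - 1) := by
  obtain ⟨bA, bB, hA, hB, hAB⟩ := hM
  refine hAB _ _ (S.belief_eq_of_prefersSub hn hh hε ht1 ht (hA _) hj) ?_
  rw [S.belief'_eq_of_prefersSub' hn hh hε ht1 ht (hB _) hj', sub_add_cancel]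

/-- An undecided α-node can occur only where the preference of the β-nodes switches to suboptimal,
that is, at the first position of their window of residues. -/
theorem completion_light_unique {i : ι} {j j' : ℤ} (hj : IsLight p (p i j) (M (p i j)))
    (hj' : IsLight p (p i j') (M (p i j'))) : (L i : ℤ) ∣ j - j' := by
  have hL := S.two_le i
  have key : ∀ j, IsLight p (p i j) (M (p i j)) → (L i : ℤ) ∣ j + ((t + 1) / 2 : ℕ) := by
    intro j hj
    rw [S.isLight_iff] at hj
    have h1 : ¬ (¬ PrefersSub (L i) t j ∧ ¬ PrefersSub' (L i) t j) := fun h1 =>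
      hj.1 (S.completion_opt hn hh hε ht1 ht hM h1.1 h1.2)
    have h2 : ¬ (PrefersSub (L i) t j ∧ PrefersSub' (L i) t (j - 1)) := fun h2 =>
      hj.2 (S.completion_sub hn hh hε ht1 ht hM h2.1 h2.2)
    -- The α-window agrees with the β-window for even `t` and is shifted by one for odd `t`; both
    -- cases give the same switch.
    have h3 : PrefersSub' (L i) t j ∧ ¬ PrefersSub' (L i) t (j - 1) := by
      rcases Nat.even_or_odd' t with ⟨u, hu | hu⟩
      · have : PrefersSub (L i) t j ↔ PrefersSub' (L i) t j := by
          unfold PrefersSub PrefersSub'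
          rw [show (t + 1) / 2 = t / 2 by omega]
        tauto
      · have : PrefersSub (L i) t j ↔ PrefersSub' (L i) t (j - 1) := by
          unfold PrefersSub PrefersSub'
          rw [show j - 1 + (((t + 1) / 2 : ℕ) : ℤ) = j + (t / 2 : ℕ) by omega]
        tauto
    unfold PrefersSub' at h3
    generalize hx : j + (((t + 1) / 2 : ℕ) : ℤ) = x at h3 ⊢
    rw [show j - 1 + (((t + 1) / 2 : ℕ) : ℤ) = x - 1 by omega] at h3
    by_contra hd
    have e1 := Int.emod_add_mul_ediv x (L i)
    have e2 := Int.emod_nonneg x (b := (L i : ℤ)) (by omega)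
    have e3 := Int.emod_lt_of_pos x (b := (L i : ℤ)) (by omega)
    have e4 : x % L i ≠ 0 := fun h0 => hd (Int.dvd_of_emod_eq_zero h0)
    have e5 : x - 1 = (x % L i - 1) + L i * (x / L i) := by linarith
    have e6 : (x - 1) % L i = x % L i - 1 := by
      rw [e5, Int.add_mul_emod_self_left, Int.emod_eq_of_lt (by omega) (by omega)]
    omega
  have := dvd_sub (key j hj) (key j' hj')
  rwa [add_sub_add_right_eq_sub] at this

/-- For even `t` one residue outside the common window suffices. For odd `t` the windows are shifted
by one, so two consecutive outside residues are needed, which excludes `t % L i = L i - 1`. -/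
theorem completion_exists_opt {i : ι}
    (h2 : Odd t → t % L i ≠ L i - 1) : ∃ j, M (p i j) = p i j := by
  have hL := S.two_le i
  have hr : t % L i < L i := Nat.mod_lt _ (by omega)
  have e1 : (-1 : ℤ) % L i = L i - 1 := by
    rw [← Int.add_emod_right, Int.emod_eq_of_lt] <;> omega
  have e2 : (-2 : ℤ) % L i = L i - 2 := by
    rw [← Int.add_emod_right, Int.emod_eq_of_lt] <;> omega
  rcases Nat.even_or_odd t with he | ho
  · refine ⟨-1 - (t / 2 : ℕ), S.completion_opt hn hh hε ht1 ht hM ?_ ?_⟩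
    · unfold PrefersSub
      rw [sub_add_cancel, e1]
      omega
    · unfold PrefersSub'
      rw [show (t + 1) / 2 = t / 2 by grind, sub_add_cancel, e1]
      omega
  · have := h2 ho
    refine ⟨-2 - (t / 2 : ℕ), S.completion_opt hn hh hε ht1 ht hM ?_ ?_⟩
    · unfold PrefersSub
      rw [sub_add_cancel, e2]
      omega
    · unfold PrefersSub'
      rw [show (t + 1) / 2 = t / 2 + 1 by grind,
        show -2 - ((t / 2 : ℕ) : ℤ) + (t / 2 + 1 : ℕ) = -1 by push_cast; ring, e1]
      omega

/-- Suboptimal edges join neighbouring positions, so the parities swap roles: for even `t` the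
window needs two residues, for odd `t` one. -/
theorem completion_exists_sub {i : ι} (h0 : t % L i ≠ 0)
    (h1 : Even t → t % L i ≠ 1) : ∃ j, M (p i j) = p i (j - 1) := by
  have hL := S.two_le i
  have hr : t % L i < L i := Nat.mod_lt _ (by omega)
  rcases Nat.even_or_odd t with he | ho
  · have := h1 he
    refine ⟨1 - (t / 2 : ℕ), S.completion_sub hn hh hε ht1 ht hM ?_ ?_⟩
    · unfold PrefersSub
      rw [sub_add_cancel, Int.emod_eq_of_lt] <;> omega
    · unfold PrefersSub'
      rw [show (t + 1) / 2 = t / 2 by grind,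
        show 1 - ((t / 2 : ℕ) : ℤ) - 1 + (t / 2 : ℕ) = 0 by ring, Int.zero_emod]
      omega
  · refine ⟨-(t / 2 : ℕ), S.completion_sub hn hh hε ht1 ht hM ?_ ?_⟩
    · unfold PrefersSub
      rw [neg_add_cancel, Int.zero_emod]
      omega
    · unfold PrefersSub'
      rw [show (t + 1) / 2 = t / 2 + 1 by grind,
        show -((t / 2 : ℕ) : ℤ) - 1 + (t / 2 + 1 : ℕ) = 0 by push_cast; ring, Int.zero_emod]
      omega

end beliefs

end CycleSystem
namespace CycleSystem

variable {n : ℕ} {ι : Type*} {w : Fin n → Fin n → ℝ} {h ε : ℝ} {L : ι → ℕ} {p : ι → ℤ → Fin n}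

/-! ### Weights of perfect matchings on a system of cycles -/

theorem node_emod (S : CycleSystem w h ε L p) (i : ι) (j : ℤ) :
    p i ((j % (L i : ℤ)).toNat : ℤ) = p i j := by
  have := S.two_le i
  rw [S.node_eq, Int.toNat_of_nonneg (Int.emod_nonneg _ (by omega))]
  exact ⟨rfl, by rw [Int.emod_def]; exact ⟨-(j / L i), by ring⟩⟩

theorem emod_toNat_lt (S : CycleSystem w h ε L p) (i : ι) (j : ℤ) :
    (j % (L i : ℤ)).toNat < L i := by
  have := S.two_le i
  have := Int.emod_lt_of_pos j (b := (L i : ℤ)) (by omega)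
  omega

open Classical in
theorem sum_eq_cycles_add_isolated [Fintype ι] (S : CycleSystem w h ε L p) (f : Fin n → ℝ) :
    ∑ k, f k = ∑ i, ∑ j ∈ range (L i), f (p i j) +
      ∑ k ∈ univ.filter (fun k => ∀ i j, k ≠ p i j), f k := by
  rw [← Finset.sum_filter_add_sum_filter_not univ (fun k => ∀ i j, k ≠ p i j), add_comm,
    Finset.sum_sigma']
  congr 1
  rw [← Finset.sum_image (g := fun x : (Σ _ : ι, ℕ) => p x.1 x.2)]
  · refine Finset.sum_congr ?_ fun _ _ => rfl
    ext k
    simp only [mem_filter, mem_univ, true_and, mem_image, mem_sigma, mem_range]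
    push Not
    constructor
    · rintro ⟨i, j, rfl⟩
      exact ⟨⟨i, (j % (L i : ℤ)).toNat⟩, S.emod_toNat_lt i j, S.node_emod i j⟩
    · rintro ⟨x, -, rfl⟩
      exact ⟨_, _, rfl⟩
  · rintro ⟨i, j⟩ hj ⟨i', j'⟩ hj' he
    simp only [coe_sigma, coe_univ, Set.mem_sigma_iff, mem_coe, mem_range] at hj hj'
    obtain ⟨rfl, hd⟩ := (S.node_eq _ _ _ _).1 he
    dsimp only at hj hj' hd
    have hlt : |(j : ℤ) - j'| < L i := by rw [abs_lt]; omega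
    have := Int.eq_zero_of_abs_lt_dvd hd hlt
    obtain rfl : j = j' := by omega
    rfl

/-- The weight that the perfect matching `M` loses on the nodes of the `i`-th cycle. -/
def cycleLoss (w : Fin n → Fin n → ℝ) (h : ℝ) (L : ι → ℕ) (p : ι → ℤ → Fin n)
    (M : Equiv.Perm (Fin n)) (i : ι) : ℝ :=
  ∑ j ∈ range (L i), (h / 2 - w (p i j) (M (p i j)))

open Classical in
theorem matchingWeight_eq [Fintype ι] (S : CycleSystem w h ε L p) (M : Equiv.Perm (Fin n)) :
    matchingWeight w M = n * (h / 2) - ∑ i, cycleLoss w h L p M i -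
      ∑ k ∈ univ.filter (fun k => ∀ i j, k ≠ p i j), (h / 2 - w k (M k)) := by
  have h1 := S.sum_eq_cycles_add_isolated fun k => h / 2 - w k (M k)
  rw [Finset.sum_sub_distrib, Finset.sum_const, card_univ, Fintype.card_fin, nsmul_eq_mul] at h1
  simp only [matchingWeight, cycleLoss]
  linarith

theorem isLight_of_isolated {k l : Fin n} (hk : ∀ i j, k ≠ p i j) (hl : l ≠ k) : IsLight p k l :=
  ⟨hl.symm, fun i j he => absurd he (hk i j)⟩

theorem loss_isolated_nonneg (S : CycleSystem w h ε L p) (hh : 0 < h) {k : Fin n}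
    (hk : ∀ i j, k ≠ p i j) (l : Fin n) : 0 ≤ h / 2 - w k l := by
  by_cases hl : l = k
  · rw [hl, S.opt, sub_self]
  · rw [S.light k l (isLight_of_isolated hk hl)]
    linarith

theorem dvd_natCast_iff {i : ι} {j : ℕ} (hj : j < L i) :
    (L i : ℤ) ∣ j ↔ j = 0 := by
  rw [Int.natCast_dvd_natCast]
  exact ⟨fun hd => Nat.eq_zero_of_dvd_of_lt hd hj, by rintro rfl; exact dvd_zero _⟩

open Classical in
-- Only the heavy edge, at position 0, can gain over `h / 2`, so each cycle gains at most `h / 2` in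
-- total; a light edge costs `5 * h / 2`.
theorem le_loss (S : CycleSystem w h ε L p) (hh : 0 < h) (hε : 0 < ε) (i : ι) {j : ℕ}
    (hj : j < L i) (l : Fin n) :
    (if j = 0 then -(h / 2) else 0) + (if IsLight p (p i j) l then 5 * h / 2 else 0) ≤
      h / 2 - w (p i j) l := by
  by_cases hl : IsLight p (p i j) l
  · rw [S.light _ _ hl, if_pos hl]
    split_ifs <;> linarith
  · rw [if_neg hl]
    rw [S.isLight_iff] at hl
    by_cases ho : l = p i j
    · rw [ho, S.opt]
      split_ifs <;> linarith
    · have hs : l = p i (j - 1) := by tauto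
      rw [hs, S.sub, edgeLoss]
      simp only [dvd_natCast_iff hj]
      have := edgeLoss_pos hh hε (S.two_le i)
      split_ifs <;> linarith

open Classical in
theorem loss_le (S : CycleSystem w h ε L p) (hh : 0 < h) (hε : 0 < ε) (i : ι) {j : ℕ}
    (hj : j < L i) (l : Fin n) :
    h / 2 - w (p i j) l ≤ (if j = 0 then 0 else (h / 2 + ε) / ((L i : ℝ) - 1)) +
      (if IsLight p (p i j) l then 5 * h / 2 else 0) := by
  have := edgeLoss_pos hh hε (S.two_le i)
  by_cases hl : IsLight p (p i j) l
  · rw [S.light _ _ hl, if_pos hl]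
    split_ifs <;> linarith
  · rw [if_neg hl]
    rw [S.isLight_iff] at hl
    by_cases ho : l = p i j
    · rw [ho, S.opt]
      split_ifs <;> linarith
    · have hs : l = p i (j - 1) := by tauto
      rw [hs, S.sub, edgeLoss]
      simp only [dvd_natCast_iff hj]
      split_ifs <;> linarith

theorem le_cycleLoss_of_isLight (S : CycleSystem w h ε L p) (hh : 0 < h) (hε : 0 < ε)
    {M : Equiv.Perm (Fin n)} {i : ι} {j : ℤ} (hj : IsLight p (p i j) (M (p i j))) :
    2 * h ≤ cycleLoss w h L p M i := by
  classical
  have h1 : ∑ j ∈ range (L i), ((if j = 0 then -(h / 2) else 0) +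
      (if IsLight p (p i j) (M (p i j)) then 5 * h / 2 else 0)) ≤ cycleLoss w h L p M i :=
    Finset.sum_le_sum fun j hj => S.le_loss hh hε i (mem_range.1 hj) _
  have hL := S.two_le i
  rw [Finset.sum_add_distrib, Finset.sum_ite_eq' _ 0 (fun _ => -(h / 2)),
    if_pos (mem_range.2 (by omega))] at h1
  have h2 := Finset.single_le_sum
    (f := fun j : ℕ => if IsLight p (p i j) (M (p i j)) then 5 * h / 2 else 0)
    (fun j _ => by split_ifs <;> linarith) (mem_range.2 (S.emod_toNat_lt i j))
  simp only [S.node_emod, if_pos hj] at h2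
  linarith

/-- At most one light edge costs `5 * h / 2`, and the ordinary edges together cost at most `h / 2 +
ε`. -/
theorem cycleLoss_le (S : CycleSystem w h ε L p) (hh : 0 < h) (hε : 0 < ε) (hεh : ε ≤ h)
    {M : Equiv.Perm (Fin n)} {i : ι} (hu : ∀ j j' : ℤ, IsLight p (p i j) (M (p i j)) →
      IsLight p (p i j') (M (p i j')) → (L i : ℤ) ∣ j - j') :
    cycleLoss w h L p M i ≤ 4 * h := by
  classical
  have h1 : cycleLoss w h L p M i ≤
      ∑ j ∈ range (L i), ((if j = 0 then 0 else (h / 2 + ε) / ((L i : ℝ) - 1)) +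
      (if IsLight p (p i j) (M (p i j)) then 5 * h / 2 else 0)) :=
    Finset.sum_le_sum fun j hj => S.loss_le hh hε i (mem_range.1 hj) _
  have hL := S.two_le i
  have h2 : ∑ j ∈ range (L i), (if j = 0 then 0 else (h / 2 + ε) / ((L i : ℝ) - 1)) =
      h / 2 + ε := by
    refine Eq.trans ?_ (sub_one_mul_edgeLoss (h := h) (ε := ε) hL)
    generalize (h / 2 + ε) / ((L i : ℝ) - 1) = d
    obtain ⟨m, hm⟩ : ∃ m, L i = m + 1 := ⟨L i - 1, by omega⟩
    rw [hm, Finset.sum_range_succ']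
    simp
  have h3 : ∑ j ∈ range (L i), (if IsLight p (p i j) (M (p i j)) then 5 * h / 2 else 0) ≤
      5 * h / 2 := by
    rw [← Finset.sum_filter, Finset.sum_const, nsmul_eq_mul]
    have : ((range (L i)).filter fun j : ℕ => IsLight p (p i j) (M (p i j))).card ≤ 1 := by
      rw [Finset.card_le_one]
      intro j hj j' hj'
      simp only [mem_filter, mem_range] at hj hj'
      have hd := hu _ _ hj.2 hj'.2
      have hlt : |(j : ℤ) - j'| < L i := by rw [abs_lt]; omega
      have := Int.eq_zero_of_abs_lt_dvd hd hlt
      omega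
    have : (((range (L i)).filter fun j : ℕ => IsLight p (p i j) (M (p i j))).card : ℝ) ≤ 1 := by
      exact_mod_cast this
    nlinarith
  rw [Finset.sum_add_distrib, h2] at h1
  linarith

theorem cycleLoss_eq_zero (S : CycleSystem w h ε L p) {M : Equiv.Perm (Fin n)} {i : ι}
    (hM : ∀ j, M (p i j) = p i j) : cycleLoss w h L p M i = 0 :=
  Finset.sum_eq_zero fun j _ => by rw [hM, S.opt, sub_self]

theorem cycleLoss_eq_gap (S : CycleSystem w h ε L p) {M : Equiv.Perm (Fin n)} {i : ι}
    (hM : ∀ j, M (p i j) = p i (j - 1)) : cycleLoss w h L p M i = ε := by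
  have hL := S.two_le i
  have h1 : cycleLoss w h L p M i = lossSum h ε (L i) 0 (L i) :=
    Finset.sum_congr rfl fun j _ => by
      rw [hM, S.sub, zero_sub, edgeLoss_neg, sub_sub_cancel]
  rw [h1, lossSum_formula hL, Nat.mod_self, if_neg (by simp), Nat.div_self (by omega)]
  simp

/-- Once an α-node takes its optimal edge, the next one finds its suboptimal partner occupied, so
the choice propagates around the cycle. -/
theorem opt_or_sub_of_not_isLight (S : CycleSystem w h ε L p) {M : Equiv.Perm (Fin n)} {i : ι}
    (hM : ∀ j, ¬ IsLight p (p i j) (M (p i j))) :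
    (∀ j, M (p i j) = p i j) ∨ ∀ j, M (p i j) = p i (j - 1) := by
  have hM' : ∀ j, M (p i j) = p i j ∨ M (p i j) = p i (j - 1) := fun j => by
    have := hM j
    rw [S.isLight_iff] at this
    tauto
  by_cases hex : ∃ j₀, M (p i j₀) = p i j₀
  · left
    obtain ⟨j₀, hj₀⟩ := hex
    have up : ∀ j, j₀ ≤ j → M (p i j) = p i j := fun j hj => by
      induction j, hj using Int.leInduction with
      | base => exact hj₀
      | succ j _ ih =>
        refine (hM' (j + 1)).resolve_right fun h1 => ?_
        rw [add_sub_cancel_right] at h1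
        have h2 := M.injective (h1.trans ih.symm)
        exact S.node_sub_one_ne i (j + 1) (by rw [add_sub_cancel_right]; exact h2.symm)
    intro j
    have hL := S.two_le i
    -- Going round often enough brings any `j` above `j₀`.
    have hper : p i (j + L i * |j₀ - j|) = p i j :=
      (S.node_eq _ _ _ _).2 ⟨rfl, ⟨|j₀ - j|, by ring⟩⟩
    rw [← hper]
    refine up _ ?_
    have h1 := le_abs_self (j₀ - j)
    have h2 := abs_nonneg (j₀ - j)
    nlinarith
  · right
    push Not at hex
    exact fun j => (hM' j).resolve_left (hex j)

theorem cycleLoss_nonneg (S : CycleSystem w h ε L p) (hh : 0 < h) (hε : 0 < ε)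
    (M : Equiv.Perm (Fin n)) (i : ι) : 0 ≤ cycleLoss w h L p M i := by
  by_cases hl : ∃ j, IsLight p (p i j) (M (p i j))
  · obtain ⟨j, hj⟩ := hl
    have := S.le_cycleLoss_of_isLight hh hε hj
    linarith
  · push Not at hl
    rcases S.opt_or_sub_of_not_isLight hl with h1 | h1
    · exact (S.cycleLoss_eq_zero h1).ge
    · exact hε.le.trans (S.cycleLoss_eq_gap h1).ge

theorem matchingWeight_one (S : CycleSystem w h ε L p) :
    matchingWeight w (1 : Equiv.Perm (Fin n)) = n * (h / 2) := by
  simp [matchingWeight, S.opt]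

theorem exists_rotation (S : CycleSystem w h ε L p) (i : ι) :
    ∃ M : Equiv.Perm (Fin n), (∀ j, M (p i j) = p i (j - 1)) ∧
      ∀ k, (∀ j, k ≠ p i j) → M k = k := by
  classical
  let f : Fin n → Fin n := fun k => if hk : ∃ j, k = p i j then p i (hk.choose - 1) else k
  have hf : ∀ j, f (p i j) = p i (j - 1) := fun j => by
    have hk : ∃ j', p i j = p i j' := ⟨j, rfl⟩
    simp only [f, dif_pos hk]
    exact (S.node_sub_one hk.choose_spec).symm
  have hf' : ∀ k, (∀ j, k ≠ p i j) → f k = k := fun k hk => by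
    have : ¬ ∃ j, k = p i j := by push Not; exact hk
    simp only [f, dif_neg this]
  have hinj : Function.Injective f := by
    intro k k' he
    by_cases hk : ∀ j, k ≠ p i j <;> by_cases hk' : ∀ j, k' ≠ p i j
    · rwa [hf' k hk, hf' k' hk'] at he
    · push Not at hk'
      obtain ⟨j, rfl⟩ := hk'
      rw [hf' k hk, hf] at he
      exact absurd he (hk _)
    · push Not at hk
      obtain ⟨j, rfl⟩ := hk
      rw [hf' k' hk', hf] at he
      exact absurd he.symm (hk' _)
    · push Not at hk hk'
      obtain ⟨j, rfl⟩ := hk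
      obtain ⟨j', rfl⟩ := hk'
      rw [hf, hf, S.node_eq, sub_sub_sub_cancel_right] at he
      exact (S.node_eq _ _ _ _).2 he
  exact ⟨Equiv.ofBijective f (Finite.injective_iff_bijective.1 hinj), hf, hf'⟩

theorem isGreatest_abs (S : CycleSystem w h ε L p) (hh : 0 < h) (hε : 0 < ε) (hεh : ε ≤ h)
    {k l : Fin n} (hkl : IsLight p k l) :
    IsGreatest (Set.range fun e : Fin n × Fin n => |w e.1 e.2|) (2 * h) := by
  refine ⟨⟨(k, l), ?_⟩, ?_⟩
  · simp only [S.light k l hkl]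
    rw [abs_neg, abs_of_pos (by linarith)]
  · rintro _ ⟨⟨k, l⟩, rfl⟩
    simp only
    rw [abs_le]
    by_cases hl : IsLight p k l
    · rw [S.light k l hl]; constructor <;> linarith
    by_cases ho : k = l
    · rw [ho, S.opt]; constructor <;> linarith
    · have : ∃ i j, k = p i j ∧ l = p i (j - 1) := by
        by_contra! hne
        exact hl ⟨ho, fun i j hk hl' => hne i j hk hl'⟩
      obtain ⟨i, j, rfl, rfl⟩ := this
      rw [S.sub, edgeLoss]
      have hL : (2 : ℝ) ≤ L i := by exact_mod_cast S.two_le i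
      have h1 := edgeLoss_pos hh hε (S.two_le i)
      have h2 := sub_one_mul_edgeLoss (h := h) (ε := ε) (S.two_le i)
      split_ifs
      · constructor <;> linarith
      · constructor <;> nlinarith

variable [Fintype ι]

theorem matchingWeight_le (S : CycleSystem w h ε L p) (hh : 0 < h) (hε : 0 < ε)
    {M : Equiv.Perm (Fin n)} (B : Finset ι)
    (hB : ∀ i ∈ B, ∃ j, IsLight p (p i j) (M (p i j))) :
    matchingWeight w M ≤ n * (h / 2) - 2 * h * B.card := by
  classical
  rw [S.matchingWeight_eq]
  have h1 : ∑ i ∈ B, 2 * h ≤ ∑ i, cycleLoss w h L p M i :=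
    (Finset.sum_le_sum fun i hi => S.le_cycleLoss_of_isLight hh hε (hB i hi).choose_spec).trans
      (Finset.sum_le_sum_of_subset_of_nonneg (subset_univ _)
        fun i _ _ => S.cycleLoss_nonneg hh hε M i)
  rw [Finset.sum_const, nsmul_eq_mul] at h1
  have h2 : 0 ≤ ∑ k ∈ univ.filter (fun k => ∀ i j, k ≠ p i j), (h / 2 - w k (M k)) :=
    Finset.sum_nonneg fun k hk => S.loss_isolated_nonneg hh (mem_filter.1 hk).2 _
  linarith

theorem matchingWeight_le_sub_gap (S : CycleSystem w h ε L p) (hh : 0 < h) (hε : 0 < ε)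
    (hεh : ε ≤ h) {M : Equiv.Perm (Fin n)} (hM : M ≠ 1) :
    matchingWeight w M ≤ n * (h / 2) - ε := by
  classical
  rw [S.matchingWeight_eq]
  have h1 : 0 ≤ ∑ i, cycleLoss w h L p M i :=
    Finset.sum_nonneg fun i _ => S.cycleLoss_nonneg hh hε M i
  have h2 : 0 ≤ ∑ k ∈ univ.filter (fun k => ∀ i j, k ≠ p i j), (h / 2 - w k (M k)) :=
    Finset.sum_nonneg fun k hk => S.loss_isolated_nonneg hh (mem_filter.1 hk).2 _
  obtain ⟨k, hk⟩ : ∃ k, M k ≠ k := by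
    by_contra! hne
    exact hM (Equiv.ext hne)
  by_cases hi : ∀ i j, k ≠ p i j
  · have h3 := Finset.single_le_sum (f := fun k => h / 2 - w k (M k))
      (fun k hk => S.loss_isolated_nonneg hh (mem_filter.1 hk).2 _)
      (mem_filter.2 ⟨mem_univ k, hi⟩)
    simp only [S.light _ _ (isLight_of_isolated hi hk)] at h3
    linarith
  · push Not at hi
    obtain ⟨i, j, rfl⟩ := hi
    have h3 := Finset.single_le_sum (f := fun i => cycleLoss w h L p M i)
      (fun i _ => S.cycleLoss_nonneg hh hε M i) (mem_univ i)
    have h4 : ε ≤ cycleLoss w h L p M i := by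
      by_cases hl : ∃ j, IsLight p (p i j) (M (p i j))
      · obtain ⟨j, hj⟩ := hl
        have := S.le_cycleLoss_of_isLight hh hε hj
        linarith
      · push Not at hl
        rcases S.opt_or_sub_of_not_isLight hl with h1 | h1
        · exact absurd (h1 j) hk
        · exact (S.cycleLoss_eq_gap h1).ge
    linarith

theorem le_matchingWeight (S : CycleSystem w h ε L p) (hh : 0 < h) (hε : 0 < ε) (hεh : ε ≤ h)
    {M : Equiv.Perm (Fin n)} (hiso : ∀ k, (∀ i j, k ≠ p i j) → M k = k)
    (hu : ∀ i, ∀ j j' : ℤ, IsLight p (p i j) (M (p i j)) →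
      IsLight p (p i j') (M (p i j')) → (L i : ℤ) ∣ j - j') :
    n * (h / 2) - 4 * h * Fintype.card ι ≤ matchingWeight w M := by
  classical
  rw [S.matchingWeight_eq]
  have h1 : ∑ i, cycleLoss w h L p M i ≤ ∑ _i : ι, 4 * h :=
    Finset.sum_le_sum fun i _ => S.cycleLoss_le hh hε hεh (hu i)
  rw [Finset.sum_const, nsmul_eq_mul, card_univ] at h1
  have h2 : ∑ k ∈ univ.filter (fun k => ∀ i j, k ≠ p i j), (h / 2 - w k (M k)) = 0 :=
    Finset.sum_eq_zero fun k hk => by rw [hiso k (mem_filter.1 hk).2, S.opt, sub_self]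
  linarith

theorem exists_matchingWeight_eq_sub_gap (S : CycleSystem w h ε L p) (i : ι) :
    ∃ M : Equiv.Perm (Fin n), M ≠ 1 ∧ matchingWeight w M = n * (h / 2) - ε := by
  classical
  obtain ⟨M, hM, hM'⟩ := S.exists_rotation i
  refine ⟨M, fun h1 => S.node_sub_one_ne i 0 ?_, ?_⟩
  · rw [← hM, h1, Equiv.Perm.one_apply]
  · rw [S.matchingWeight_eq]
    have h1 : ∑ i', cycleLoss w h L p M i' = ε := by
      rw [Finset.sum_eq_single i, S.cycleLoss_eq_gap hM]
      · intro i' _ hi'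
        refine S.cycleLoss_eq_zero fun j => hM' _ fun j' he => hi' ((S.node_eq _ _ _ _).1 he).1
      · exact fun hi => absurd (mem_univ i) hi
    have h2 : ∑ k ∈ univ.filter (fun k => ∀ i j, k ≠ p i j), (h / 2 - w k (M k)) = 0 :=
      Finset.sum_eq_zero fun k hk => by
        rw [hM' k fun j => (mem_filter.1 hk).2 i j, S.opt, sub_self]
    rw [h1, h2, sub_zero]

theorem optWeight_eq (S : CycleSystem w h ε L p) (hh : 0 < h) (hε : 0 < ε) :
    optWeight w = n * (h / 2) := by
  refine le_antisymm (Finset.sup'_le _ _ fun M _ => ?_) ?_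
  · have := S.matchingWeight_le hh hε (M := M) ∅ (by simp)
    simpa using this
  · rw [← S.matchingWeight_one]
    exact Finset.le_sup' _ (mem_univ _)

theorem isUniquenessGap (S : CycleSystem w h ε L p) (hh : 0 < h) (hε : 0 < ε) (hεh : ε ≤ h)
    (i : ι) : IsUniquenessGap w ε := by
  obtain ⟨M, hM, hw⟩ := S.exists_matchingWeight_eq_sub_gap i
  refine ⟨1, M, hM, ?_, ?_, fun M'' hM'' => ?_⟩
  · rw [S.matchingWeight_one, hw]; ring
  · rw [S.matchingWeight_one, hw]; linarith
  · rw [hw]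
    exact S.matchingWeight_le_sub_gap hh hε hεh hM''

end CycleSystem

/-! ### Construction of the weights and of the cycles -/

theorem edgeLoss_congr (h ε : ℝ) {L : ℕ} {j j' : ℤ} (hd : (L : ℤ) ∣ j - j') :
    edgeLoss h ε L j = edgeLoss h ε L j' := by
  unfold edgeLoss
  simp only [dvd_iff_dvd_of_dvd_sub hd]

theorem exists_cycleSystem {n : ℕ} {ι : Type*} (h ε : ℝ) {L : ι → ℕ} {p : ι → ℤ → Fin n}
    (hL : ∀ i, 2 ≤ L i)
    (hp : ∀ i i' j j', p i j = p i' j' ↔ i = i' ∧ (L i : ℤ) ∣ j - j') :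
    ∃ w, CycleSystem w h ε L p := by
  classical
  let w : Fin n → Fin n → ℝ := fun k l =>
    if k = l then h / 2
    else if hx : ∃ x : ι × ℤ, k = p x.1 x.2 ∧ l = p x.1 (x.2 - 1) then
      h / 2 - edgeLoss h ε (L hx.choose.1) hx.choose.2
    else -(2 * h)
  refine ⟨w, hL, hp, fun k => if_pos rfl, fun i j => ?_, fun k l hkl => ?_⟩
  · have hne : p i j ≠ p i (j - 1) := by
      intro he
      have h1 := ((hp _ _ _ _).1 he).2
      rw [sub_sub_cancel] at h1
      have h2 := Int.le_of_dvd one_pos h1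
      have := hL i
      omega
    have hx : ∃ x : ι × ℤ, p i j = p x.1 x.2 ∧ p i (j - 1) = p x.1 (x.2 - 1) :=
      ⟨(i, j), rfl, rfl⟩
    simp only [w, if_neg hne, dif_pos hx]
    obtain ⟨h1, h2⟩ := (hp _ _ _ _).1 hx.choose_spec.1
    rw [← h1, edgeLoss_congr h ε h2]
  · have hx : ¬ ∃ x : ι × ℤ, k = p x.1 x.2 ∧ l = p x.1 (x.2 - 1) := fun ⟨x, hk, hl⟩ =>
      hkl.2 _ _ hk hl
    simp only [w, if_neg hkl.1, dif_neg hx]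

/-! ### From finite positions to periodic indices -/

namespace PrimeCycles

variable {n c : ℕ} (C : PrimeCycles n c)

theorem emod_toNat_lt (i : Fin c) (j : ℤ) : (j % (C.len i : ℤ)).toNat < C.len i := by
  have := (C.prime i).pos
  have := Int.emod_lt_of_pos j (b := (C.len i : ℤ)) (by omega)
  omega

/-- The nodes of the `i`-th cycle, indexed periodically by the integers. -/
def periodicNode (i : Fin c) (j : ℤ) : Fin n := C.node i ⟨(j % C.len i).toNat, C.emod_toNat_lt i j⟩

theorem periodicNode_eq_iff (i i' : Fin c) (j j' : ℤ) :
    C.periodicNode i j = C.periodicNode i' j' ↔ i = i' ∧ (C.len i : ℤ) ∣ j - j' := by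
  have hpos := (C.prime i).pos
  have h1 := Int.emod_nonneg j (b := (C.len i : ℤ)) (by omega)
  have h2 := Int.emod_nonneg j' (b := (C.len i : ℤ)) (by omega)
  constructor
  · intro he
    obtain ⟨rfl, hj⟩ := C.disjoint _ _ _ _ he
    refine ⟨rfl, ?_⟩
    dsimp only at hj
    refine Int.ModEq.dvd ?_
    change j' % _ = j % _
    omega
  · rintro ⟨rfl, hd⟩
    have : j' % (C.len i : ℤ) = j % C.len i := (Int.modEq_iff_dvd.2 hd)
    simp only [periodicNode, this]

theorem periodicNode_natCast {i : Fin c} (j : Fin (C.len i)) :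
    C.periodicNode i (j : ℕ) = C.node i j := by
  unfold periodicNode
  congr 1
  ext
  simp only
  rw [Int.emod_eq_of_lt] <;> omega

theorem isSubEdge_iff (i : Fin c) (k l : Fin n) : C.IsSubEdge i k l ↔
    ∃ j : ℤ, ¬ (C.len i : ℤ) ∣ j ∧ k = C.periodicNode i j ∧ l = C.periodicNode i (j - 1) := by
  have hL := (C.prime i).two_le
  constructor
  · rintro ⟨j, j', hj, rfl, rfl⟩
    refine ⟨(j' : ℕ), ?_, (C.periodicNode_natCast j').symm, ?_⟩
    · rw [Int.natCast_dvd_natCast]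
      exact fun hd => by
        have := Nat.le_of_dvd (by omega) hd
        omega
    · rw [← C.periodicNode_natCast, hj]
      congr 1
      push_cast
      ring
  · rintro ⟨j, hj, rfl, rfl⟩
    refine ⟨_, _, ?_, rfl, rfl⟩
    dsimp only
    have e1 := Int.emod_add_mul_ediv j (C.len i)
    have e2 := Int.emod_nonneg j (b := (C.len i : ℤ)) (by omega)
    have e3 := Int.emod_lt_of_pos j (b := (C.len i : ℤ)) (by omega)
    have e4 : j % C.len i ≠ 0 := fun h0 => hj (Int.dvd_of_emod_eq_zero h0)
    have e5 : j - 1 = (j % C.len i - 1) + C.len i * (j / C.len i) := by linarith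
    have e6 : (j - 1) % C.len i = j % C.len i - 1 := by
      rw [e5, Int.add_mul_emod_self_left, Int.emod_eq_of_lt (by omega) (by omega)]
    omega

theorem isHeavyEdge_iff (i : Fin c) (k l : Fin n) : C.IsHeavyEdge i k l ↔
    ∃ j : ℤ, (C.len i : ℤ) ∣ j ∧ k = C.periodicNode i j ∧ l = C.periodicNode i (j - 1) := by
  have hL := (C.prime i).two_le
  constructor
  · rintro ⟨j, j', hj', hj, rfl, rfl⟩
    refine ⟨0, dvd_zero _, ?_, ?_⟩
    · rw [← C.periodicNode_natCast, hj']
      rfl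
    · rw [← C.periodicNode_natCast, C.periodicNode_eq_iff]
      exact ⟨rfl, ⟨1, by omega⟩⟩
  · rintro ⟨j, hj, rfl, rfl⟩
    refine ⟨_, _, ?_, ?_, rfl, rfl⟩
    · dsimp only
      rw [Int.emod_eq_zero_of_dvd hj]
      rfl
    · dsimp only
      obtain ⟨a, rfl⟩ := hj
      have e6 : ((C.len i : ℤ) * a - 1) % C.len i = C.len i - 1 := by
        rw [show (C.len i : ℤ) * a - 1 = (C.len i - 1) + C.len i * (a - 1) by ring,
          Int.add_mul_emod_self_left, Int.emod_eq_of_lt (by omega) (by omega)]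
      omega

theorem isWeight_of_cycleSystem {h ε : ℝ} {w : Fin n → Fin n → ℝ}
    (S : CycleSystem w h ε C.len C.periodicNode) : C.IsWeight h ε w where
  opt := S.opt
  sub i k l hkl := by
    obtain ⟨j, hj, rfl, rfl⟩ := (C.isSubEdge_iff i k l).1 hkl
    have hL : (2 : ℝ) ≤ C.len i := by exact_mod_cast S.two_le i
    rw [S.sub, edgeLoss, if_neg hj]
    field_simp [show (C.len i : ℝ) - 1 ≠ 0 by linarith]
    ring
  heavy i k l hkl := by
    obtain ⟨j, hj, rfl, rfl⟩ := (C.isHeavyEdge_iff i k l).1 hkl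
    rw [S.sub, edgeLoss, if_pos hj]
    ring
  light k l hkl hne := by
    refine S.light k l ⟨hkl, fun i j hk hl => ?_⟩
    by_cases hd : (C.len i : ℤ) ∣ j
    · exact (hne i).2 ((C.isHeavyEdge_iff i k l).2 ⟨j, hd, hk, hl⟩)
    · exact (hne i).1 ((C.isSubEdge_iff i k l).2 ⟨j, hd, hk, hl⟩)

end PrimeCycles

/-- The primes in the interval `(m, 2m]`. -/
def upperPrimes (m : ℕ) : Finset ℕ := (Finset.Ioc m (2 * m)).filter Nat.Prime

/-- Any `c` primes in `(m, 2 * m]` have sum at most `2 * m * c ≤ n`, so disjoint cycles of these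
half-lengths fit. -/
theorem nonempty_primeCycles {n c : ℕ} (hc : 0 < c) (hm : 2 ≤ n / (2 * c))
    (hcard : c ≤ (upperPrimes (n / (2 * c))).card) : Nonempty (PrimeCycles n c) := by
  set m := n / (2 * c) with hmdef
  obtain ⟨s, hs, hsc⟩ := Finset.exists_subset_card_eq hcard
  let len : Fin c → ℕ := fun i => s.orderEmbOfFin hsc i
  have hmem : ∀ i, len i ∈ upperPrimes m := fun i => hs (s.orderEmbOfFin_mem hsc i)
  simp only [upperPrimes, mem_filter, mem_Ioc] at hmem
  have hmn : m * (2 * c) ≤ n := Nat.div_mul_le_self _ _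
  have hnm : n < (m + 1) * (2 * c) := by
    have := Nat.lt_mul_div_succ n (show 0 < 2 * c by omega)
    rw [mul_comm]
    exact this
  have hcR : (0 : ℝ) < c := by exact_mod_cast hc
  have hsum : Fintype.card (Σ i : Fin c, Fin (len i)) ≤ Fintype.card (Fin n) := by
    rw [Fintype.card_sigma, Fintype.card_fin]
    calc ∑ i, Fintype.card (Fin (len i)) ≤ ∑ _i : Fin c, 2 * m :=
          Finset.sum_le_sum fun i _ => by rw [Fintype.card_fin]; exact (hmem i).1.2
      _ = m * (2 * c) := by rw [Finset.sum_const, card_univ, Fintype.card_fin, smul_eq_mul]; ring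
      _ ≤ n := hmn
  obtain ⟨e⟩ := Function.Embedding.nonempty_of_card_le hsum
  refine ⟨⟨len, fun i => (hmem i).2, (s.orderEmbOfFin hsc).strictMono, fun i => ?_, fun i => ?_,
    fun i j => e ⟨i, j⟩, fun i j i' j' he => ?_⟩⟩
  · rw [div_lt_iff₀ (by positivity)]
    have h1 : m + 1 ≤ len i := (hmem i).1.1
    have : n < len i * (2 * c) := hnm.trans_le (Nat.mul_le_mul_right _ h1)
    exact_mod_cast this
  · rw [lt_div_iff₀ hcR]
    -- The interval has to be open at `n / c`; the endpoint `2 * m` is not prime.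
    have h1 : len i < 2 * m := by
      refine lt_of_le_of_ne (hmem i).1.2 fun he => ?_
      have := (hmem i).2
      rw [he] at this
      exact Nat.not_prime_mul (by norm_num) (by omega) this
    have : len i * c < n := lt_of_lt_of_le (Nat.mul_lt_mul_of_pos_right h1 hc) (by linarith)
    exact_mod_cast this
  · have h1 := e.injective he
    simp only [Sigma.mk.injEq] at h1
    obtain ⟨rfl, h2⟩ := h1
    exact ⟨rfl, by rw [eq_of_heq h2]⟩

/-! ### Cycles in which belief propagation may find an optimal or second best matching -/

/-- In iteration `t`, belief propagation may complete one of the two perfect matchings of a cycle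
of half-length `L`. -/
def IsSettled (L t : ℕ) : Prop :=
  t % L = 0 ∨ (Even t ∧ t % L = 1) ∨ (Odd t ∧ t % L = L - 1)

theorem CycleSystem.exists_isLight_of_not_isSettled {n : ℕ} {ι : Type*} {w : Fin n → Fin n → ℝ}
    {h ε : ℝ} {L : ι → ℕ} {p : ι → ℤ → Fin n} {t : ℕ} (S : CycleSystem w h ε L p) (hn : 2 ≤ n)
    (hh : 0 < h) (hε : 0 < ε) (ht1 : 1 ≤ t) (ht : ∀ i, ((t : ℝ) + L i) * ε ≤ h / 4)
    {M : Equiv.Perm (Fin n)} (hM : IsCompletion w t M) {i : ι} (hi : ¬ IsSettled (L i) t) :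
    ∃ j, IsLight p (p i j) (M (p i j)) := by
  unfold IsSettled at hi
  push Not at hi
  obtain ⟨j₁, hj₁⟩ := S.completion_exists_opt hn hh hε ht1 ht hM (i := i) hi.2.2
  obtain ⟨j₂, hj₂⟩ := S.completion_exists_sub hn hh hε ht1 ht hM hi.1 hi.2.1
  by_contra! hne
  rcases S.opt_or_sub_of_not_isLight hne with h1 | h1
  · rw [h1] at hj₂
    exact S.node_sub_one_ne i j₂ hj₂.symm
  · rw [h1] at hj₁
    exact S.node_sub_one_ne i j₁ hj₁

/-- All settled half-lengths divide the same number, `t * (t - 1)` for even `t` and `t * (t + 1)`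
for odd `t`, and distinct primes are coprime. -/
theorem prod_settled_le {c t : ℕ} (ht : 1 ≤ t) {len : Fin c → ℕ} (hlen : Function.Injective len)
    (hp : ∀ i, (len i).Prime) (A : Finset (Fin c)) (hA : ∀ i ∈ A, IsSettled (len i) t) :
    ∏ i ∈ A, len i ≤ 2 * t ^ 2 := by
  obtain ⟨u, hu0, hu, hdvd⟩ : ∃ u, 0 < u ∧ u ≤ 2 * t ^ 2 ∧ ∀ i ∈ A, len i ∣ u := by
    rcases Nat.even_or_odd t with he | ho
    · have ht2 : 2 ≤ t := by
        obtain ⟨v, hv⟩ := he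
        omega
      refine ⟨t * (t - 1), Nat.mul_pos ht (by omega), ?_, fun i hi => ?_⟩
      · have : t - 1 ≤ t := Nat.sub_le _ _
        nlinarith
      · rcases hA i hi with h1 | h1 | h1
        · exact (Nat.dvd_of_mod_eq_zero h1).mul_right _
        · exact ((Nat.modEq_iff_dvd' ht).1 (by
            change 1 % _ = t % _
            rw [h1.2, Nat.mod_eq_of_lt (hp i).one_lt])).mul_left _
        · exact absurd he (Nat.not_even_iff_odd.2 h1.1)
    · refine ⟨t * (t + 1), by positivity, by nlinarith, fun i hi => ?_⟩
      rcases hA i hi with h1 | h1 | h1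
      · exact (Nat.dvd_of_mod_eq_zero h1).mul_right _
      · exact absurd h1.1 (Nat.not_even_iff_odd.2 ho)
      · refine Dvd.dvd.mul_left (Nat.dvd_of_mod_eq_zero ?_) _
        have := (hp i).one_lt
        rw [Nat.add_mod, h1.2, Nat.mod_eq_of_lt (hp i).one_lt, Nat.sub_add_cancel (by omega),
          Nat.mod_self]
  refine (Nat.le_of_dvd hu0 ?_).trans hu
  refine Finset.prod_dvd_of_isRelPrime (fun i _ j _ hij => ?_) hdvd
  exact Nat.coprime_iff_isRelPrime.1 ((Nat.coprime_primes (hp i) (hp j)).2 (hlen.ne hij))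

/-! ### Primes between `m` and `2m` -/

/-- Erdős's factorization, keeping the primes in `(m, 2 * m]`: prime powers are at most `2 * m`,
primes above `√(2 * m)` occur at most once, those in `(2 * m / 3, m]` not at all, and the middle
range is bounded by a primorial. -/
theorem centralBinom_le_upperPrimes {m : ℕ} (hm : 2 < m) :
    m.centralBinom ≤
      (2 * m) ^ Nat.sqrt (2 * m) * 4 ^ (2 * m / 3) * (2 * m) ^ (upperPrimes m).card := by
  let f : ℕ → ℕ := fun x => x ^ m.centralBinom.factorization x
  let S := (range (2 * m / 3 + 1)).filter Nat.Prime
  have hf : ∀ x, f x ≤ 2 * m := fun x => Nat.pow_factorization_choose_le (by omega)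
  have hdisj : Disjoint S (upperPrimes m) := by
    rw [Finset.disjoint_left]
    intro x hx hx'
    simp only [S, upperPrimes, mem_filter, mem_range, mem_Ioc] at hx hx'
    omega
  have hprod : m.centralBinom = (∏ x ∈ S, f x) * ∏ x ∈ upperPrimes m, f x := by
    rw [← Finset.prod_union hdisj, ← Nat.prod_pow_factorization_centralBinom m]
    refine (Finset.prod_subset ?_ fun x hx hx' => ?_).symm
    · intro x hx
      simp only [S, upperPrimes, mem_union, mem_filter, mem_range, mem_Ioc] at hx ⊢
      omega
    · simp only [S, upperPrimes, mem_union, mem_filter, mem_range, mem_Ioc] at hx hx'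
      by_cases hp : x.Prime
      · rw [Nat.factorization_centralBinom_of_two_mul_self_lt_three_mul hm
          (by by_contra h; exact hx' (Or.inr ⟨by omega, hp⟩))
          (by by_contra h; exact hx' (Or.inl ⟨by omega, hp⟩)), pow_zero]
      · rw [Nat.factorization_eq_zero_of_not_prime _ hp, pow_zero]
  rw [hprod]
  refine Nat.mul_le_mul ?_ ?_
  · rw [← Finset.prod_filter_mul_prod_filter_not S (· ≤ Nat.sqrt (2 * m))]
    refine Nat.mul_le_mul ?_ ?_
    · refine (Finset.prod_le_pow_card _ _ _ fun x _ => hf x).trans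
        (Nat.pow_le_pow_right (by omega) ?_)
      have : (Finset.Icc 1 (Nat.sqrt (2 * m))).card = Nat.sqrt (2 * m) := by
        rw [Nat.card_Icc, Nat.add_sub_cancel]
      refine (Finset.card_le_card fun x hx => ?_).trans this.le
      obtain ⟨h1, h2⟩ := Finset.mem_filter.1 hx
      exact Finset.mem_Icc.mpr ⟨(Finset.mem_filter.1 h1).2.one_lt.le, h2⟩
    · refine le_trans ?_ (primorial_le_four_pow (2 * m / 3))
      refine (Finset.prod_le_prod' fun p hp => (?_ : f p ≤ p)).trans ?_
      · obtain ⟨h1, h2⟩ := Finset.mem_filter.1 hp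
        refine (Nat.pow_le_pow_right (Finset.mem_filter.1 h1).2.pos ?_).trans (pow_one p).le
        exact Nat.factorization_choose_le_one (Nat.sqrt_lt'.mp <| not_le.1 h2)
      · refine Finset.prod_le_prod_of_subset_of_one_le' (Finset.filter_subset _ _) ?_
        exact fun p hp _ => (Finset.mem_filter.1 hp).2.one_lt.le
  · exact Finset.prod_le_pow_card _ _ _ fun x _ => hf x

theorem mul_log_four_le_upperPrimes {m : ℕ} (hm : 4 ≤ m) :
    (m : ℝ) / 3 * Real.log 4 ≤
      ((upperPrimes m).card + Real.sqrt (2 * m) + 1) * Real.log (2 * m) := by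
  have h1 : 4 ^ m ≤ (2 * m) * ((2 * m) ^ Nat.sqrt (2 * m) * 4 ^ (2 * m / 3) *
      (2 * m) ^ (upperPrimes m).card) :=
    (Nat.four_pow_lt_mul_centralBinom m hm).le.trans
      (Nat.mul_le_mul (by omega) (centralBinom_le_upperPrimes (by omega)))
  have h2 : (4 : ℝ) ^ m ≤ (2 * m) * ((2 * m) ^ Nat.sqrt (2 * m) * 4 ^ (2 * m / 3) *
      (2 * m) ^ (upperPrimes m).card) := by exact_mod_cast h1
  have hm' : (4 : ℝ) ≤ m := by exact_mod_cast hm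
  have hpos : (0 : ℝ) < 2 * m := by linarith
  have h4 : ((2 * m / 3 : ℕ) : ℝ) ≤ 2 * m / 3 := by
    have := Nat.cast_div_le (α := ℝ) (m := 2 * m) (n := 3)
    push_cast at this
    exact this
  have h5 : ((Nat.sqrt (2 * m) : ℕ) : ℝ) ≤ Real.sqrt (2 * m) := by
    have := Real.nat_sqrt_le_real_sqrt (a := 2 * m)
    push_cast at this
    exact this
  generalize hN : 2 * (m : ℝ) = N at *
  have h3 := Real.log_le_log (by positivity) h2
  rw [Real.log_mul (by positivity) (by positivity), Real.log_mul (by positivity) (by positivity),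
    Real.log_mul (by positivity) (by positivity), Real.log_pow, Real.log_pow, Real.log_pow,
    Real.log_pow] at h3
  have h6 : 0 ≤ Real.log 4 := Real.log_nonneg (by norm_num)
  have h7 : 0 ≤ Real.log N := Real.log_nonneg (by linarith)
  nlinarith [mul_le_mul_of_nonneg_right h4 h6, mul_le_mul_of_nonneg_right h5 h7]

/-! ### The parameters of the construction -/

/-- The size requirements on `n`, in terms of `l = log n` and `s = √(n / log n)`. -/
structure LargeScale (n : ℕ) (s l : ℝ) : Prop where
  log_eq : Real.log n = l
  sqrt_eq : Real.sqrt (n / l) = s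
  le_log : 100 ≤ l
  le_sqrt : 1000 * l ≤ s

theorem exists_largeScale :
    ∃ N : ℕ, ∀ n : ℕ, N ≤ n → LargeScale n (Real.sqrt (n / Real.log n)) (Real.log n) := by
  have h1 : ∀ᶠ x : ℝ in Filter.atTop, 100 ≤ Real.log x :=
    Real.tendsto_log_atTop.eventually_ge_atTop 100
  -- The cube makes `n / log n` at least `(1000 * log n) ^ 2`.
  have h2 : ∀ᶠ x : ℝ in Filter.atTop, ‖Real.log x ^ 3‖ ≤ 1 / 1000000 * ‖x‖ :=
    (Real.isLittleO_pow_log_id_atTop (n := 3)).bound (by norm_num)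
  have h3 := tendsto_natCast_atTop_atTop (R := ℝ) |>.eventually (h1.and h2)
  obtain ⟨N, hN⟩ := Filter.eventually_atTop.1 h3
  refine ⟨N, fun n hn => ⟨rfl, rfl, (hN n hn).1, ?_⟩⟩
  obtain ⟨h4, h5⟩ := hN n hn
  set l := Real.log n
  rw [Real.norm_of_nonneg (by positivity), Real.norm_of_nonneg (Nat.cast_nonneg _)] at h5
  apply Real.le_sqrt_of_sq_le
  rw [le_div_iff₀ (by linarith)]
  nlinarith

namespace LargeScale

variable {n : ℕ} {s l : ℝ}

theorem sqrt_pos (H : LargeScale n s l) : 100000 ≤ s := by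
  linarith [H.le_log, H.le_sqrt]

theorem eq_sq_mul (H : LargeScale n s l) : (n : ℝ) = s ^ 2 * l := by
  have hl := H.le_log
  rw [← H.sqrt_eq, Real.sq_sqrt (by positivity)]
  field_simp

/-- From `n = s ^ 2 * l`, `log (s * l) = (l + log l) / 2`. The primes in use thus have logarithm
only about `l / 2`, which leaves room in the prime count. -/
theorem log_le (H : LargeScale n s l) : Real.log (4 * (s * l)) ≤ 3 / 5 * l := by
  have hl := H.le_log
  have hs := H.sqrt_pos
  have h1 : l = 2 * Real.log s + Real.log l := by
    conv_lhs => rw [← H.log_eq, H.eq_sq_mul]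
    rw [Real.log_mul (by positivity) (by positivity), Real.log_pow]
    norm_num
  have h2 : Real.log (4 * (s * l)) = 2 * Real.log 2 + (Real.log s + Real.log l) := by
    rw [Real.log_mul (by positivity) (by positivity), Real.log_mul (by positivity) (by positivity),
      show (4 : ℝ) = 2 ^ 2 by norm_num, Real.log_pow]
    norm_num
  have h3 : Real.log l ≤ l / 64 - 1 + 6 * Real.log 2 := by
    have h4 := Real.log_le_sub_one_of_pos (show 0 < l / 64 by positivity)
    rw [Real.log_div (by positivity) (by norm_num), show (64 : ℝ) = 2 ^ 6 by norm_num,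
      Real.log_pow] at h4
    norm_num at h4 ⊢
    linarith
  have h5 := Real.log_two_lt_d9
  linarith

theorem floor_le (H : LargeScale n s l) : (⌊s / 2⌋₊ : ℝ) ≤ s / 2 :=
  Nat.floor_le (by linarith [H.sqrt_pos])

theorem mul_le_div (H : LargeScale n s l) : s * l ≤ (n : ℝ) / (2 * (⌊s / 2⌋₊ : ℝ)) := by
  have h1 := H.floor_le
  have h2 := Nat.sub_one_lt_floor (s / 2)
  have hs := H.sqrt_pos
  have hl := H.le_log
  rw [le_div_iff₀ (by linarith), H.eq_sq_mul]
  have : 0 ≤ s * l := by positivity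
  nlinarith

theorem le_card_upperPrimes (H : LargeScale n s l) :
    4 ≤ n / (2 * ⌊s / 2⌋₊) ∧ ⌊s / 2⌋₊ ≤ (upperPrimes (n / (2 * ⌊s / 2⌋₊))).card := by
  have h1 := H.floor_le
  have h2 := Nat.sub_one_lt_floor (s / 2)
  have hs := H.sqrt_pos
  have hl := H.le_log
  have hsl := H.le_sqrt
  have h3 := H.mul_le_div
  generalize ⌊s / 2⌋₊ = c at *
  set m := n / (2 * c) with hm
  have hc : (0 : ℝ) < c := by linarith
  have hc' : 0 < c := by exact_mod_cast hc
  have h4 : (n : ℝ) / (2 * c) < m + 1 := by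
    rw [div_lt_iff₀ (by positivity)]
    have := Nat.lt_mul_div_succ n (show 0 < 2 * c by omega)
    rw [mul_comm]
    exact_mod_cast this
  have h5 : (m : ℝ) * (2 * c) ≤ n := by exact_mod_cast Nat.div_mul_le_self n (2 * c)
  have hsl' : 10000000 ≤ s * l := by nlinarith
  have hm4 : 4 ≤ m := by
    have : (4 : ℝ) ≤ m := by linarith
    exact_mod_cast this
  refine ⟨hm4, ?_⟩
  have hm4' : (4 : ℝ) ≤ m := by exact_mod_cast hm4
  -- With fewer than `s / 2` primes the right side of `mul_log_four_le_upperPrimes` is at most about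
  -- `0.35 * s * l`, while the left side is about `0.46 * s * l` or more.
  by_contra! hlt
  have hU : ((upperPrimes m).card : ℝ) ≤ s / 2 := by
    have : ((upperPrimes m).card : ℝ) ≤ c := by exact_mod_cast hlt.le
    linarith
  have h6 : 2 * (m : ℝ) ≤ 4 * (s * l) := by
    rw [H.eq_sq_mul] at h5
    have h7 : (m : ℝ) * (s / 2) ≤ m * (2 * c) := by
      apply mul_le_mul_of_nonneg_left _ (by positivity)
      linarith
    have h8 : (m : ℝ) * s ≤ (2 * (s * l)) * s := by nlinarith
    have := le_of_mul_le_mul_right h8 (by linarith)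
    linarith
  have h7 : Real.sqrt (2 * m) ≤ 7 / 100 * s := by
    rw [Real.sqrt_le_left (by positivity)]
    nlinarith
  have h8 : Real.log (2 * m) ≤ 3 / 5 * l :=
    (Real.log_le_log (by positivity) h6).trans H.log_le
  have h9 := mul_log_four_le_upperPrimes hm4
  have h10 : ((upperPrimes m).card + Real.sqrt (2 * m) + 1) * Real.log (2 * m) ≤
      (58 / 100 * s) * (3 / 5 * l) := by
    apply mul_le_mul _ h8 (Real.log_nonneg (by linarith)) (by positivity)
    linarith
  have h11 : 138 / 100 ≤ Real.log 4 := by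
    rw [show (4 : ℝ) = 2 ^ 2 by norm_num, Real.log_pow]
    have := Real.log_two_gt_d9
    norm_num
    linarith
  have h12 : (m : ℝ) / 3 * (138 / 100) ≤ m / 3 * Real.log 4 :=
    mul_le_mul_of_nonneg_left h11 (by positivity)
  nlinarith

/-- Each half-length exceeds `s * l = √(n * l)`. More than `s / 8` settled ones would have product
at least `(s * l) ^ (s / 8)`, but `2 * t ^ 2` is at most `2 * (s * l) ^ (s / 16)`. -/
theorem card_settled_le (H : LargeScale n s l) (C : PrimeCycles n ⌊s / 2⌋₊) {t : ℕ} (ht : 1 ≤ t)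
    (hts : (t : ℝ) ≤ ((n : ℝ) * l) ^ (1 / 64 * s)) (A : Finset (Fin ⌊s / 2⌋₊))
    (hA : ∀ i ∈ A, IsSettled (C.len i) t) : (A.card : ℝ) ≤ s / 8 := by
  have hs := H.sqrt_pos
  have hl := H.le_log
  have hsl' : 10000000 ≤ s * l := by nlinarith
  by_contra! hlt
  have h1 : ((∏ i ∈ A, C.len i : ℕ) : ℝ) ≤ 2 * (t : ℝ) ^ 2 := by
    exact_mod_cast prod_settled_le ht C.strictMono.injective C.prime A hA
  have h2 : (s * l) ^ A.card ≤ ((∏ i ∈ A, C.len i : ℕ) : ℝ) := by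
    rw [← Finset.prod_const, Nat.cast_prod]
    exact Finset.prod_le_prod (fun i _ => by linarith)
      fun i _ => H.mul_le_div.trans (C.lower i).le
  have h3 : (s * l) ^ (s / 8) ≤ (s * l) ^ A.card := by
    rw [← Real.rpow_natCast]
    exact Real.rpow_le_rpow_of_exponent_le (by linarith) hlt.le
  have h4 : (t : ℝ) ^ 2 ≤ (s * l) ^ (s / 16) := by
    calc (t : ℝ) ^ 2 ≤ (((n : ℝ) * l) ^ (1 / 64 * s)) ^ 2 :=
          pow_le_pow_left₀ (Nat.cast_nonneg _) hts 2
      _ = (s * l) ^ (s / 16) := by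
          rw [show (n : ℝ) * l = (s * l) ^ (2 : ℝ) by rw [H.eq_sq_mul, Real.rpow_two]; ring,
            ← Real.rpow_mul (by linarith), ← Real.rpow_natCast, ← Real.rpow_mul (by linarith)]
          congr 1
          push_cast
          ring
  have h5 : (s * l) ^ (s / 8) = (s * l) ^ (s / 16) * (s * l) ^ (s / 16) := by
    rw [← Real.rpow_add (by linarith)]
    congr 1
    ring
  have h6 : s * l ≤ (s * l) ^ (s / 16) := by
    conv_lhs => rw [← Real.rpow_one (s * l)]
    exact Real.rpow_le_rpow_of_exponent_le (by linarith) (by linarith)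
  nlinarith

end LargeScale

/-! ### Combining the estimates -/

theorem LargeScale.early_iterations_small {n : ℕ} {s l h ε : ℝ} (H : LargeScale n s l)
    (hh : 0 < h) (hε : 0 < ε) (hgap : ε < 2 * h / (4 * ((n : ℝ) - 2)))
    (C : PrimeCycles n ⌊s / 2⌋₊) {t : ℕ}
    (ht : (t : ℝ) ≤ 1 / 16 * (2 * h / (Real.sqrt ((n : ℝ) ^ 3 / l) * ε))) (i : Fin ⌊s / 2⌋₊) :
    ((t : ℝ) + C.len i) * ε ≤ h / 4 := by
  have hs := H.sqrt_pos
  have hl := H.le_log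
  have hc := Nat.sub_one_lt_floor (s / 2)
  have hn : 1000 ≤ (n : ℝ) := by rw [H.eq_sq_mul]; nlinarith
  have h1 : (C.len i : ℝ) * ε ≤ h / 8 := by
    have h2 : (C.len i : ℝ) ≤ n / 16 := by
      refine (C.upper i).le.trans ?_
      exact div_le_div_of_nonneg_left (by linarith) (by norm_num) (by linarith)
    rw [lt_div_iff₀ (by linarith)] at hgap
    have h3 : (C.len i : ℝ) * ε ≤ n / 16 * ε := mul_le_mul_of_nonneg_right h2 hε.le
    nlinarith
  have h2 : (t : ℝ) * ε ≤ h / 8 := by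
    -- Only this crude bound is needed: `t * ε ≤ h / 8` already suffices.
    have hq : 1 ≤ Real.sqrt ((n : ℝ) ^ 3 / l) := by
      rw [Real.one_le_sqrt, one_le_div (by linarith)]
      have h3 : l ≤ n := by
        rw [H.eq_sq_mul]
        exact le_mul_of_one_le_left (by linarith) (one_le_pow₀ (by linarith))
      have h4 : (n : ℝ) ≤ n ^ 3 := le_self_pow₀ (by linarith) (by norm_num)
      linarith
    have h5 : 2 * h / (Real.sqrt ((n : ℝ) ^ 3 / l) * ε) ≤ 2 * h / ε := by
      apply div_le_div_of_nonneg_left (by linarith) hε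
      nlinarith
    have h6 : (t : ℝ) ≤ h / 8 / ε := by
      calc (t : ℝ) ≤ 1 / 16 * (2 * h / ε) := by linarith
        _ = h / 8 / ε := by ring
    rwa [le_div_iff₀ hε] at h6
  linarith

theorem LargeScale.sqrt_mul {n : ℕ} {s l : ℝ} (H : LargeScale n s l) :
    Real.sqrt ((n : ℝ) * l) = s * l := by
  have hs := H.sqrt_pos
  have hl := H.le_log
  rw [show (n : ℝ) * l = (s * l) ^ 2 by rw [H.eq_sq_mul]; ring, Real.sqrt_sq (by positivity)]

/-- Of the roughly `s / 2` cycles at most `s / 8` are settled, so at least `s / 8` lose `2 * h`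
each; all together lose at most `4 * h * (s / 2)`. -/
theorem LargeScale.completion_bounds {n : ℕ} {s l h ε : ℝ} (H : LargeScale n s l)
    (hh : 0 < h) (hε : 0 < ε) (hgap : ε < 2 * h / (4 * ((n : ℝ) - 2)))
    (C : PrimeCycles n ⌊s / 2⌋₊) {w : Fin n → Fin n → ℝ}
    (S : CycleSystem w h ε C.len C.periodicNode) {t : ℕ} (ht1 : 1 ≤ t)
    (hts : (t : ℝ) ≤ ((n : ℝ) * l) ^ (1 / 64 * s))
    (htε : (t : ℝ) ≤ 1 / 16 * (2 * h / (Real.sqrt ((n : ℝ) ^ 3 / l) * ε)))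
    {M : Equiv.Perm (Fin n)} (hM : IsCompletion w t M) :
    (1 - 4 / (s * l)) * (n * (h / 2)) ≤ matchingWeight w M ∧
      matchingWeight w M ≤ (1 - 1 / 2 / (s * l)) * (n * (h / 2)) := by
  classical
  have hs := H.sqrt_pos
  have hl := H.le_log
  have hc := Nat.sub_one_lt_floor (s / 2)
  have hc' := H.floor_le
  have hnR : 1000 ≤ (n : ℝ) := by rw [H.eq_sq_mul]; nlinarith
  have hn : 2 ≤ n := by
    have : (2 : ℝ) ≤ n := by linarith
    exact_mod_cast this
  have ht := H.early_iterations_small hh hε hgap C htε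
  have hεh : ε ≤ h := by
    rw [lt_div_iff₀ (by linarith)] at hgap
    nlinarith
  have hdiv : ∀ x : ℝ, (1 - x / (s * l)) * (n * (h / 2)) = n * (h / 2) - x * s * h / 2 := by
    intro x
    rw [H.eq_sq_mul]
    field_simp
  rw [hdiv, hdiv]
  constructor
  · have h1 := S.le_matchingWeight hh hε hεh (M := M)
      (fun k hk => S.completion_isolated hn hh hε ht1 ht hM hk)
      (fun i j j' hj hj' => S.completion_light_unique hn hh hε ht1 ht hM hj hj')
    rw [Fintype.card_fin] at h1
    nlinarith
  · have h1 := S.matchingWeight_le hh hε (M := M) (univ.filter fun i => ¬ IsSettled (C.len i) t)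
      fun i hi => S.exists_isLight_of_not_isSettled hn hh hε ht1 ht hM (mem_filter.1 hi).2
    have h2 := H.card_settled_le C ht1 hts (univ.filter fun i => IsSettled (C.len i) t)
      fun i hi => (mem_filter.1 hi).2
    have h3 : ((univ.filter fun i => IsSettled (C.len i) t).card : ℝ) +
        ((univ.filter fun i => ¬ IsSettled (C.len i) t).card : ℝ) = ⌊s / 2⌋₊ := by
      have := Finset.card_filter_add_card_filter_not (s := univ) fun i => IsSettled (C.len i) t
      rw [card_univ, Fintype.card_fin] at this
      exact_mod_cast this
    nlinarith

end BPMatching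
end

theorem theorem3 :
    ∃ a b c₁ c₂ : ℝ, 0 < a ∧ 0 < b ∧ 0 < c₁ ∧ 0 < c₂ ∧
      ∃ N : ℕ, ∀ n : ℕ, N ≤ n → ∀ wmax ε : ℝ, 0 < wmax → 0 < ε →
        ε < wmax / (4 * ((n : ℝ) - 2)) →
        ∃ w : Fin n → Fin n → ℝ,
          -- the maximum absolute weight is `wmax`, and the uniqueness gap is `ε`
          IsGreatest (Set.range fun e : Fin n × Fin n => |w e.1 e.2|) wmax ∧
          BPMatching.IsUniquenessGap w ε ∧
          -- the weights are those of a union of cycles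
          (∃ C : BPMatching.PrimeCycles n ⌊Real.sqrt ((n : ℝ) / Real.log n) / 2⌋₊,
            C.IsWeight (wmax / 2) ε w) ∧
          -- completions of early partial BP matchings
          0 < BPMatching.optWeight w ∧
          ∀ t : ℕ, 1 ≤ t →
            (t : ℝ) ≤ min
              (((n : ℝ) * Real.log n) ^ (a * Real.sqrt ((n : ℝ) / Real.log n)))
              (b * (wmax / (Real.sqrt ((n : ℝ) ^ 3 / Real.log n) * ε))) →
            ∀ M : Equiv.Perm (Fin n), BPMatching.IsCompletion w t M →
              (1 - c₂ / Real.sqrt ((n : ℝ) * Real.log n)) * BPMatching.optWeight w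
                  ≤ BPMatching.matchingWeight w M ∧
              BPMatching.matchingWeight w M
                  ≤ (1 - c₁ / Real.sqrt ((n : ℝ) * Real.log n)) * BPMatching.optWeight w := by
  refine ⟨1 / 64, 1 / 16, 1 / 2, 4, by norm_num, by norm_num, by norm_num, by norm_num, ?_⟩
  obtain ⟨N, hN⟩ := BPMatching.exists_largeScale
  refine ⟨N, fun n hn wmax ε hw hε hgap => ?_⟩
  have H := hN n hn
  set l := Real.log n
  set s := Real.sqrt ((n : ℝ) / l)
  obtain ⟨h, rfl⟩ : ∃ h, wmax = 2 * h := ⟨wmax / 2, by ring⟩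
  have hh : 0 < h := by linarith
  have hs := H.sqrt_pos
  have hl := H.le_log
  have hc := Nat.sub_one_lt_floor (s / 2)
  have hnR : 1000 ≤ (n : ℝ) := by rw [H.eq_sq_mul]; nlinarith
  have hεh : ε ≤ h := by
    rw [lt_div_iff₀ (by linarith)] at hgap
    nlinarith
  have hc2 : 2 ≤ ⌊s / 2⌋₊ := by
    have : (2 : ℝ) ≤ (⌊s / 2⌋₊ : ℝ) := by linarith
    exact_mod_cast this
  obtain ⟨C⟩ := BPMatching.nonempty_primeCycles (by omega) (by have := H.le_card_upperPrimes.1; omega)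
    H.le_card_upperPrimes.2
  obtain ⟨w, S⟩ := BPMatching.exists_cycleSystem h ε (fun i => (C.prime i).two_le)
    C.periodicNode_eq_iff
  -- Two distinct cycles provide a light edge, at which the maximum absolute weight `2 * h` is
  -- attained.
  let i₀ : Fin ⌊s / 2⌋₊ := ⟨0, by omega⟩
  let i₁ : Fin ⌊s / 2⌋₊ := ⟨1, by omega⟩
  have hi : i₁ ≠ i₀ := by simp [i₀, i₁]
  have hlight : BPMatching.IsLight C.periodicNode (C.periodicNode i₀ 0) (C.periodicNode i₁ 0) := by
    rw [S.isLight_iff]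
    exact ⟨fun he => hi ((S.node_eq _ _ _ _).1 he).1, fun he => hi ((S.node_eq _ _ _ _).1 he).1⟩
  refine ⟨w, S.isGreatest_abs hh hε hεh hlight, S.isUniquenessGap hh hε hεh i₀, ⟨C, ?_⟩, ?_, ?_⟩
  · rw [mul_div_cancel_left₀ h two_ne_zero]
    exact C.isWeight_of_cycleSystem S
  · rw [S.optWeight_eq hh hε]
    positivity
  · intro t ht1 ht M hM
    rw [S.optWeight_eq hh hε, H.sqrt_mul]
    exact H.completion_bounds hh hε hgap C S ht1 (ht.trans (min_le_left _ _))
      (ht.trans (min_le_right _ _)) hM
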